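/- **Theorem 3.1.** Let $k\ge 0$ be an integer and $h>0$. For $j\in\mathbb Z$ let $I_j=(x_{j-1/2},x_{j+1/2})$, $x_{j+1/2}=(j+\tfrac12)h$, $x_j=jh$, and represent a piecewise polynomial $u$ of degree at most $k$ by its coefficient vectors $\boldsymbol u_j\in\mathbb C^{k+1}$ with respect to the monomials $\big(\tfrac{x-x_j}{h/2}\big)^l$, $l=0,\dots,k$, on $I_j$. Consider the $P^k$ local discontinuous Galerkin scheme for $u_{tt}=u_{xx}$ with alternating fluxes: for all $j$ and all polynomials $w,v$ of degree at most $k$ on $I_j$, $$\int_{I_j} u_{tt}\,w=-\int_{I_j} q\,w_x+q^+_{j+1/2}w^-_{j+1/2}-q^+_{j-1/2}w^+_{j-1/2},\qquad \int_{I_j} q\,v=-\int_{I_j} u\,v_x+u^-_{j+1/2}v^-_{j+1/2}-u^-_{j-1/2}v^+_{j-1/2}.$$ With time step $\Delta t>0$ and central differences in time, elimination of $q$ gives $$M^h\,\frac{\boldsymbol u_j^{n+1}-2\boldsymbol u_j^n+\boldsymbol u_j^{n-1}}{(\Delta t)^2}+K_0^h\boldsymbol u_j^n+K_{-1}^h\boldsymbol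 u_{j-1}^n+K_{+1}^h\boldsymbol u_{j+1}^n=0,$$ where $M^h$ is the local mass matrix and $K^h_0,K^h_{\pm1}$ are the resulting real $(k+1)\times(k+1)$ stiffness blocks, which do not depend on $\Delta t$. Put $\mathcal K^h(\xi)=K_0^h+K_{-1}^he^{-\mathrm i\xi h}+K_{+1}^he^{\mathrm i\xi h}$ and consider the generalized eigenvalue problem $$(\mathcal K^h(\xi)-\sigma M^h)\boldsymbol v=0 .\tag{$*$}$$ (a) There are real-analytic functions $\sigma_0,\dots,\sigma_k:\mathbb R\to\mathbb R$ and $\boldsymbol v_0,\dots,\boldsymbol v_k:\mathbb R\to\mathbb C^{k+1}$ such that for every $\xi$ each pair $(\sigma_i(\xi),\boldsymbol v_i(\xi))$ solves $(*)$ and $\boldsymbol v_0(\xi),\dots,\boldsymbol v_k(\xi)$ is an $M^h$-orthonormal basis of $\mathbb C^{k+1}$, that is, a basis with $\boldsymbol v_i(\xi)^HM^h\boldsymbol v_j(\xi)=\delta_{ij}$. (b) Let $(\sigma_i,\boldsymbol v_i)_{i=0}^k$ be any such system, real-analytic on a neighbourhood of $\Pi_h=[-\pi/h,\pi/h]$ and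 satisfying the conditions of (a) for all $\xi\in\Pi_h$. Then exactly one index $ph$ satisfies $$\sigma_{ph}(0)=0,\qquad \boldsymbol v_{ph}(0)=c\,\boldsymbol e_0\ \text{ for some } c\in\mathbb C\setminus\{0\},\ \boldsymbol e_0=(1,0,\dots,0)^T,\qquad \sigma_{ph}''(0)=2,$$ and the remaining $k$ branches satisfy $\sigma_i(0)>0$. Moreover all branches are even: $\sigma_i(-\xi)=\sigma_i(\xi)$ for all $i$ and all $\xi\in\Pi_h$. -/

import Mathlib

open scoped Matrix

namespace LDG

noncomputable section

/-! ### The fully discrete scheme in weak form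

Cells are `I_j = (x_{j-1/2}, x_{j+1/2})` with `x_{j+1/2} = (j + 1/2) h`, and an element of the
broken polynomial space is a sequence `c : ℤ → Fin (k+1) → ℂ` of local coefficient vectors. -/

/-- The interface `x_{j+1/2} = (j + 1/2) h`. -/
def node (h : ℝ) (j : ℤ) : ℝ := ((j : ℝ) + 1 / 2) * h

/-- The monomial basis function `((x - x_j) / (h/2))^l` of the cell `I_j`, with `x_j = j h`. -/
def basisFun (h : ℝ) (j : ℤ) (l : ℕ) (x : ℝ) : ℝ := ((x - (j : ℝ) * h) / (h / 2)) ^ l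

/-- The polynomial of degree at most `k` on the cell `I_j` with coefficient vector `c`. -/
def cellPoly (k : ℕ) (h : ℝ) (j : ℤ) (c : Fin (k + 1) → ℂ) (x : ℝ) : ℂ :=
  ∑ l : Fin (k + 1), c l * (basisFun h j l x : ℂ)

/-- Weak form of `q = u_x` on every cell, tested with all polynomials `w` of degree at most `k`,
with the flux `u^-` (the trace from the left cell) at both ends of the cell. -/
def WeakAux (k : ℕ) (h : ℝ) (u q : ℤ → Fin (k + 1) → ℂ) : Prop :=
  ∀ (j : ℤ) (w : Fin (k + 1) → ℂ),
    ∫ x in node h (j - 1)..node h j, cellPoly k h j (q j) x * cellPoly k h j w x =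
      -(∫ x in node h (j - 1)..node h j, cellPoly k h j (u j) x * deriv (cellPoly k h j w) x)
        + cellPoly k h j (u j) (node h j) * cellPoly k h j w (node h j)
        - cellPoly k h (j - 1) (u (j - 1)) (node h (j - 1)) * cellPoly k h j w (node h (j - 1))

/-- Weak form of `a = q_x` on every cell (`a` stands for the second time derivative of `u`), with
the flux `q^+` (the trace from the right cell) at both ends of the cell. -/
def WeakWave (k : ℕ) (h : ℝ) (q a : ℤ → Fin (k + 1) → ℂ) : Prop :=
  ∀ (j : ℤ) (w : Fin (k + 1) → ℂ),
    ∫ x in node h (j - 1)..node h j, cellPoly k h j (a j) x * cellPoly k h j w x =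
      -(∫ x in node h (j - 1)..node h j, cellPoly k h j (q j) x * deriv (cellPoly k h j w) x)
        + cellPoly k h (j + 1) (q (j + 1)) (node h j) * cellPoly k h j w (node h j)
        - cellPoly k h j (q j) (node h (j - 1)) * cellPoly k h j w (node h (j - 1))

/-- `U n j` is the coefficient vector at time `n Δt` on the cell `I_j` of a solution of the fully
discrete scheme: central differences in time, alternating fluxes in space. -/
def IsSchemeSolution (k : ℕ) (h dt : ℝ) (U : ℕ → ℤ → Fin (k + 1) → ℂ) : Prop :=
  ∀ n : ℕ, ∃ q : ℤ → Fin (k + 1) → ℂ, WeakAux k h (U (n + 1)) q ∧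
    WeakWave k h q
      (fun j => ((dt : ℂ) ^ 2)⁻¹ • (U (n + 2) j - (2 : ℂ) • U (n + 1) j + U n j))

/-! ### The local matrices of the scheme

By translation invariance they may be computed on the cell `I_0 = (-h/2, h/2)`. -/

/-- The local mass matrix `M^h`. -/
def massMatrix (k : ℕ) (h : ℝ) : Matrix (Fin (k + 1)) (Fin (k + 1)) ℝ :=
  Matrix.of fun l m => ∫ x in (-(h / 2))..(h / 2), basisFun h 0 l x * basisFun h 0 m x

/-- The matrix of `∫ φ_m φ_l'` (row `l` belongs to the test function). -/
def derivMatrix (k : ℕ) (h : ℝ) : Matrix (Fin (k + 1)) (Fin (k + 1)) ℝ :=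
  Matrix.of fun l m => ∫ x in (-(h / 2))..(h / 2), basisFun h 0 m x * deriv (basisFun h 0 l) x

/-- Trace of the `l`-th basis function at the right end of the cell. -/
def rightTrace (k : ℕ) (h : ℝ) (l : Fin (k + 1)) : ℝ := basisFun h 0 l (h / 2)

/-- Trace of the `l`-th basis function at the left end of the cell. -/
def leftTrace (k : ℕ) (h : ℝ) (l : Fin (k + 1)) : ℝ := basisFun h 0 l (-(h / 2))

/-- With `auxDiag` and `auxLeft` the first weak equation reads
`M q_j = auxDiag u_j + auxLeft u_{j-1}`. -/
def auxDiag (k : ℕ) (h : ℝ) : Matrix (Fin (k + 1)) (Fin (k + 1)) ℝ :=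
  -derivMatrix k h + Matrix.vecMulVec (rightTrace k h) (rightTrace k h)

/-- Contribution of `u_{j-1}` to the equation for `q_j`. -/
def auxLeft (k : ℕ) (h : ℝ) : Matrix (Fin (k + 1)) (Fin (k + 1)) ℝ :=
  -Matrix.vecMulVec (leftTrace k h) (rightTrace k h)

/-- With `waveDiag` and `waveRight` the second weak equation reads
`M a_j = waveDiag q_j + waveRight q_{j+1}`. -/
def waveDiag (k : ℕ) (h : ℝ) : Matrix (Fin (k + 1)) (Fin (k + 1)) ℝ :=
  -derivMatrix k h - Matrix.vecMulVec (leftTrace k h) (leftTrace k h)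

/-- Contribution of `q_{j+1}` to the equation for `a_j`. -/
def waveRight (k : ℕ) (h : ℝ) : Matrix (Fin (k + 1)) (Fin (k + 1)) ℝ :=
  Matrix.vecMulVec (rightTrace k h) (leftTrace k h)

/-- The stiffness block `K_0^h`, obtained by eliminating `q`. -/
def stiffZero (k : ℕ) (h : ℝ) : Matrix (Fin (k + 1)) (Fin (k + 1)) ℝ :=
  -(waveDiag k h * (massMatrix k h)⁻¹ * auxDiag k h
    + waveRight k h * (massMatrix k h)⁻¹ * auxLeft k h)

/-- The stiffness block `K_{-1}^h`. -/
def stiffLeft (k : ℕ) (h : ℝ) : Matrix (Fin (k + 1)) (Fin (k + 1)) ℝ :=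
  -(waveDiag k h * (massMatrix k h)⁻¹ * auxLeft k h)

/-- The stiffness block `K_{+1}^h`. -/
def stiffRight (k : ℕ) (h : ℝ) : Matrix (Fin (k + 1)) (Fin (k + 1)) ℝ :=
  -(waveRight k h * (massMatrix k h)⁻¹ * auxDiag k h)

/-- A real matrix regarded as a complex one. -/
def toComplex {k : ℕ} (A : Matrix (Fin (k + 1)) (Fin (k + 1)) ℝ) :
    Matrix (Fin (k + 1)) (Fin (k + 1)) ℂ :=
  A.map Complex.ofReal

/-- The symbol `K^h(ξ) = K_0^h + K_{-1}^h e^{-iξh} + K_{+1}^h e^{iξh}`. -/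
def symbol (k : ℕ) (h ξ : ℝ) : Matrix (Fin (k + 1)) (Fin (k + 1)) ℂ :=
  toComplex (stiffZero k h)
    + Complex.exp (-(Complex.I * (ξ : ℂ) * (h : ℂ))) • toComplex (stiffLeft k h)
    + Complex.exp (Complex.I * (ξ : ℂ) * (h : ℂ)) • toComplex (stiffRight k h)

/-- The families `σ i`, `v i` (`i = 0, …, k`) are real-analytic eigenpairs of
`(K^h(ξ) - σ M^h) v = 0` for `ξ` in `S`, and for each such `ξ` the vectors `v i ξ` are an
`M^h`-orthonormal basis of `ℂ^(k+1)`. -/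
structure IsAnalyticEigensystem (k : ℕ) (h : ℝ) (S : Set ℝ)
    (σ : Fin (k + 1) → ℝ → ℝ) (v : Fin (k + 1) → ℝ → Fin (k + 1) → ℂ) : Prop where
  analytic_val : ∀ i, AnalyticOnNhd ℝ (σ i) S
  analytic_vec : ∀ i, AnalyticOnNhd ℝ (v i) S
  eigen : ∀ i, ∀ ξ ∈ S,
    (symbol k h ξ - (σ i ξ : ℂ) • toComplex (massMatrix k h)) *ᵥ v i ξ = 0
  orthonormal : ∀ i j, ∀ ξ ∈ S,
    star (v i ξ) ⬝ᵥ (toComplex (massMatrix k h) *ᵥ v j ξ) = if i = j then 1 else 0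
  basis : ∀ ξ ∈ S, LinearIndependent ℂ (fun i => v i ξ) ∧
    Submodule.span ℂ (Set.range fun i => v i ξ) = ⊤

/-- The branch `i` is physical: `σ_i(0) = 0`, `v_i(0)` is a nonzero multiple of
`e_0 = (1, 0, …, 0)`, and `σ_i''(0) = 2`. -/
def IsPhysicalBranch (k : ℕ) (σ : Fin (k + 1) → ℝ → ℝ)
    (v : Fin (k + 1) → ℝ → Fin (k + 1) → ℂ) (i : Fin (k + 1)) : Prop :=
  σ i 0 = 0 ∧ (∃ c : ℂ, c ≠ 0 ∧ v i 0 = c • Pi.single 0 1) ∧ iteratedDeriv 2 (σ i) 0 = 2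

/-! ### The matrices are those of the scheme -/

theorem node_sub_one (h : ℝ) (j : ℤ) : node h (j - 1) = -(h / 2) + j * h := by
  unfold node; push_cast; ring

theorem node_eq (h : ℝ) (j : ℤ) : node h j = h / 2 + j * h := by
  unfold node; ring

theorem basisFun_shift (h : ℝ) (j : ℤ) (l : ℕ) (x : ℝ) :
    basisFun h j l x = basisFun h 0 l (x - j * h) := by
  simp [basisFun]

theorem cellPoly_shift (k : ℕ) (h : ℝ) (j : ℤ) (c : Fin (k + 1) → ℂ) (x : ℝ) :
    cellPoly k h j c x = cellPoly k h 0 c (x - j * h) := by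
  unfold cellPoly
  simp_rw [basisFun_shift h j]

theorem continuous_basisFun (h : ℝ) (j : ℤ) (l : ℕ) : Continuous (basisFun h j l) := by
  unfold basisFun; fun_prop

theorem contDiff_basisFun (h : ℝ) (j : ℤ) (l : ℕ) : ContDiff ℝ 1 (basisFun h j l) := by
  unfold basisFun; fun_prop

theorem continuous_deriv_basisFun (h : ℝ) (j : ℤ) (l : ℕ) :
    Continuous (deriv (basisFun h j l)) :=
  (contDiff_basisFun h j l).continuous_deriv le_rfl

theorem deriv_cellPoly (k : ℕ) (h : ℝ) (j : ℤ) (c : Fin (k + 1) → ℂ) (x : ℝ) :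
    deriv (cellPoly k h j c) x = ∑ l : Fin (k + 1), c l * ((deriv (basisFun h j l) x : ℝ) : ℂ) := by
  apply HasDerivAt.deriv
  unfold cellPoly
  apply HasDerivAt.fun_sum
  intro l _
  exact (((contDiff_basisFun h j l).differentiable one_ne_zero x).hasDerivAt.ofReal_comp).const_mul _

theorem deriv_cellPoly_shift (k : ℕ) (h : ℝ) (j : ℤ) (c : Fin (k + 1) → ℂ) (x : ℝ) :
    deriv (cellPoly k h j c) x = deriv (cellPoly k h 0 c) (x - j * h) := by
  have : cellPoly k h j c = fun x => cellPoly k h 0 c (x - j * h) :=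
    funext (cellPoly_shift k h j c)
  rw [this, deriv_comp_sub_const]

/-- A bilinear integral of two combinations of real functions. -/
theorem integral_bilinear {n : ℕ} (f g : Fin n → ℝ → ℝ) (hf : ∀ l, Continuous (f l))
    (hg : ∀ l, Continuous (g l)) (a b : ℝ) (c w : Fin n → ℂ) :
    ∫ x in a..b, (∑ m, c m * (f m x : ℂ)) * (∑ l, w l * (g l x : ℂ)) =
      w ⬝ᵥ ((Matrix.of fun l m => ∫ x in a..b, f m x * g l x).map Complex.ofReal *ᵥ c) := by
  have e : ∀ x, (∑ m, c m * (f m x : ℂ)) * (∑ l, w l * (g l x : ℂ)) =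
      ∑ l, ∑ m, (w l * c m) * ((f m x * g l x : ℝ) : ℂ) := by
    intro x
    rw [Finset.sum_mul_sum, Finset.sum_comm]
    refine Finset.sum_congr rfl fun l _ => Finset.sum_congr rfl fun m _ => ?_
    push_cast; ring
  have hi : ∀ l m, IntervalIntegrable (fun x => (w l * c m) * ((f m x * g l x : ℝ) : ℂ))
      MeasureTheory.volume a b := by
    intro l m
    apply Continuous.intervalIntegrable
    have := hf m
    have := hg l
    fun_prop
  simp_rw [e]
  rw [intervalIntegral.integral_finsetSum]
  · simp only [dotProduct, Matrix.mulVec, Matrix.map_apply, Matrix.of_apply, Finset.mul_sum]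
    refine Finset.sum_congr rfl fun l _ => ?_
    rw [intervalIntegral.integral_finsetSum (fun m _ => hi l m)]
    refine Finset.sum_congr rfl fun m _ => ?_
    rw [intervalIntegral.integral_const_mul, intervalIntegral.integral_ofReal]
    ring
  · intro l _
    have := IntervalIntegrable.sum Finset.univ (fun m _ => hi l m)
    simpa only [Finset.sum_fn] using this

theorem integral_mass (k : ℕ) (h : ℝ) (j : ℤ) (c w : Fin (k + 1) → ℂ) :
    ∫ x in node h (j - 1)..node h j, cellPoly k h j c x * cellPoly k h j w x =
      w ⬝ᵥ (toComplex (massMatrix k h) *ᵥ c) := by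
  simp_rw [cellPoly_shift k h j]
  rw [intervalIntegral.integral_comp_sub_right (fun x => cellPoly k h 0 c x * cellPoly k h 0 w x),
    node_sub_one, node_eq, add_sub_cancel_right, add_sub_cancel_right]
  unfold cellPoly
  rw [integral_bilinear (fun l : Fin (k + 1) => basisFun h 0 l) (fun l => basisFun h 0 l)
    (fun l => continuous_basisFun h 0 l) (fun l => continuous_basisFun h 0 l)]
  simp only [toComplex, massMatrix, mul_comm]

theorem integral_deriv (k : ℕ) (h : ℝ) (j : ℤ) (c w : Fin (k + 1) → ℂ) :
    ∫ x in node h (j - 1)..node h j, cellPoly k h j c x * deriv (cellPoly k h j w) x =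
      w ⬝ᵥ (toComplex (derivMatrix k h) *ᵥ c) := by
  simp_rw [deriv_cellPoly_shift k h j, cellPoly_shift k h j]
  rw [intervalIntegral.integral_comp_sub_right
      (fun x => cellPoly k h 0 c x * deriv (cellPoly k h 0 w) x),
    node_sub_one, node_eq, add_sub_cancel_right, add_sub_cancel_right]
  simp_rw [deriv_cellPoly]
  unfold cellPoly
  rw [integral_bilinear (fun l : Fin (k + 1) => basisFun h 0 l) (fun l => deriv (basisFun h 0 l))
    (fun l => continuous_basisFun h 0 l) (fun l => continuous_deriv_basisFun h 0 l)]
  rfl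

theorem cellPoly_right (k : ℕ) (h : ℝ) (j : ℤ) (c : Fin (k + 1) → ℂ) :
    cellPoly k h j c (node h j) = ∑ l, c l * (rightTrace k h l : ℂ) := by
  rw [cellPoly_shift, node_eq, add_sub_cancel_right]; rfl

theorem cellPoly_left (k : ℕ) (h : ℝ) (j : ℤ) (c : Fin (k + 1) → ℂ) :
    cellPoly k h j c (node h (j - 1)) = ∑ l, c l * (leftTrace k h l : ℂ) := by
  rw [cellPoly_shift, node_sub_one, add_sub_cancel_right]; rfl

theorem trace_mul (k : ℕ) (a b : Fin (k + 1) → ℝ) (c w : Fin (k + 1) → ℂ) :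
    (∑ l, c l * (b l : ℂ)) * (∑ l, w l * (a l : ℂ)) =
      w ⬝ᵥ (toComplex (Matrix.vecMulVec a b) *ᵥ c) := by
  simp only [dotProduct, Matrix.mulVec, toComplex, Matrix.map_apply, Matrix.vecMulVec_apply]
  rw [Finset.sum_mul_sum, Finset.sum_comm]
  refine Finset.sum_congr rfl fun l _ => ?_
  rw [Finset.mul_sum]
  refine Finset.sum_congr rfl fun m _ => ?_
  push_cast; ring

theorem toComplex_add {k : ℕ} (A B : Matrix (Fin (k + 1)) (Fin (k + 1)) ℝ) :
    toComplex (A + B) = toComplex A + toComplex B := by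
  ext; simp [toComplex]

theorem toComplex_sub {k : ℕ} (A B : Matrix (Fin (k + 1)) (Fin (k + 1)) ℝ) :
    toComplex (A - B) = toComplex A - toComplex B := by
  ext; simp [toComplex]

theorem toComplex_neg {k : ℕ} (A : Matrix (Fin (k + 1)) (Fin (k + 1)) ℝ) :
    toComplex (-A) = -toComplex A := by
  ext; simp [toComplex]

theorem toComplex_mul {k : ℕ} (A B : Matrix (Fin (k + 1)) (Fin (k + 1)) ℝ) :
    toComplex (A * B) = toComplex A * toComplex B := by
  ext; simp [toComplex, Matrix.mul_apply]

theorem toComplex_one {k : ℕ} :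
    toComplex (1 : Matrix (Fin (k + 1)) (Fin (k + 1)) ℝ) = 1 := by
  simp [toComplex]

theorem weakAux_iff (k : ℕ) (h : ℝ) (u q : ℤ → Fin (k + 1) → ℂ) :
    WeakAux k h u q ↔ ∀ j, toComplex (massMatrix k h) *ᵥ q j =
      toComplex (auxDiag k h) *ᵥ u j + toComplex (auxLeft k h) *ᵥ u (j - 1) := by
  unfold WeakAux
  refine forall_congr' fun j => ?_
  rw [← dotProduct_eq_iff]
  refine forall_congr' fun w => ?_
  rw [dotProduct_comm _ w, dotProduct_comm _ w]
  rw [integral_mass, integral_deriv, cellPoly_right, cellPoly_right, cellPoly_right,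
    cellPoly_left, trace_mul, trace_mul]
  simp only [auxDiag, auxLeft, toComplex_add, toComplex_neg, Matrix.add_mulVec,
    Matrix.neg_mulVec, dotProduct_add, dotProduct_neg, sub_eq_add_neg]

theorem weakWave_iff (k : ℕ) (h : ℝ) (q a : ℤ → Fin (k + 1) → ℂ) :
    WeakWave k h q a ↔ ∀ j, toComplex (massMatrix k h) *ᵥ a j =
      toComplex (waveDiag k h) *ᵥ q j + toComplex (waveRight k h) *ᵥ q (j + 1) := by
  unfold WeakWave
  refine forall_congr' fun j => ?_
  rw [← dotProduct_eq_iff]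
  refine forall_congr' fun w => ?_
  rw [dotProduct_comm _ w, dotProduct_comm _ w]
  have hn : cellPoly k h (j + 1) (q (j + 1)) (node h j) =
      ∑ l, q (j + 1) l * (leftTrace k h l : ℂ) := by
    have := cellPoly_left k h (j + 1) (q (j + 1))
    rwa [add_sub_cancel_right] at this
  rw [integral_mass, integral_deriv, hn, cellPoly_right,
    cellPoly_left, cellPoly_left, trace_mul, trace_mul]
  simp only [waveDiag, waveRight, toComplex_neg, toComplex_sub, Matrix.neg_mulVec, Matrix.sub_mulVec,
    dotProduct_add, dotProduct_neg, dotProduct_sub]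
  constructor <;> intro e <;> rw [e] <;> ring

/-- The mass matrix is invertible, so that its inverse is not a junk value. -/
theorem massMatrix_isUnit_det (k : ℕ) {h : ℝ} (hh : 0 < h) : IsUnit (massMatrix k h).det := by
  rw [isUnit_iff_ne_zero]
  intro hdet
  obtain ⟨c, hc, hMc⟩ := Matrix.exists_mulVec_eq_zero_iff.2 hdet
  have hint : ∫ x in (-(h / 2))..(h / 2), (∑ l : Fin (k + 1), c l * basisFun h 0 l x) ^ 2 = 0 := by
    have h1 := integral_bilinear (fun l : Fin (k + 1) => basisFun h 0 l)
      (fun l => basisFun h 0 l) (fun l => continuous_basisFun h 0 l)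
      (fun l => continuous_basisFun h 0 l) (-(h / 2)) (h / 2)
      (fun l => (c l : ℂ)) (fun l => (c l : ℂ))
    have h2 : (Matrix.of fun l m : Fin (k + 1) =>
        ∫ x in (-(h / 2))..(h / 2), basisFun h 0 m x * basisFun h 0 l x) = massMatrix k h := by
      simp only [massMatrix, mul_comm]
    rw [h2] at h1
    have h3 : ((massMatrix k h).map Complex.ofReal *ᵥ fun l => (c l : ℂ)) = 0 := by
      ext i
      have := congrFun hMc i
      simp only [Matrix.mulVec, dotProduct, Matrix.map_apply, Pi.zero_apply] at this ⊢
      exact_mod_cast this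
    rw [h3, dotProduct_zero] at h1
    have h4 : ∀ x, (∑ m : Fin (k + 1), (c m : ℂ) * (basisFun h 0 m x : ℂ)) *
        (∑ l : Fin (k + 1), (c l : ℂ) * (basisFun h 0 l x : ℂ)) =
        (((∑ l : Fin (k + 1), c l * basisFun h 0 l x) ^ 2 : ℝ) : ℂ) := by
      intro x; push_cast; ring
    simp_rw [h4] at h1
    rw [intervalIntegral.integral_ofReal] at h1
    exact_mod_cast h1
  have hcont : Continuous fun x => ∑ l : Fin (k + 1), c l * basisFun h 0 l x :=
    continuous_finsetSum _ fun l _ => continuous_const.mul (continuous_basisFun h 0 l)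
  have hzero : ∀ x ∈ Set.Ioo (-(h / 2)) (h / 2),
      ∑ l : Fin (k + 1), c l * basisFun h 0 l x = 0 := by
    intro x hx
    by_contra hne
    have hlt : -(h / 2) < h / 2 := by linarith
    have hpos := intervalIntegral.integral_pos hlt
      (f := fun x => (∑ l : Fin (k + 1), c l * basisFun h 0 l x) ^ 2)
      (hcont.pow 2).continuousOn (fun y _ => sq_nonneg _)
      ⟨x, Set.Ioo_subset_Icc_self hx, by positivity⟩
    exact hpos.ne' hint
  let p : Polynomial ℝ := ∑ l : Fin (k + 1), Polynomial.monomial (l : ℕ) (c l)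
  have hp : p = 0 := by
    apply Polynomial.eq_zero_of_infinite_isRoot
    refine (Set.Ioo_infinite (show (-1 : ℝ) < 1 by norm_num)).mono ?_
    intro y hy
    have := hzero (y * (h / 2)) ⟨by nlinarith [hy.1], by nlinarith [hy.2]⟩
    have hh2 : h / 2 ≠ 0 := by positivity
    simp only [basisFun, Int.cast_zero, zero_mul, sub_zero, mul_div_cancel_right₀ _ hh2] at this
    simpa [p, Polynomial.IsRoot, Polynomial.eval_finsetSum] using this
  apply hc
  ext i
  have := congrArg (fun r => Polynomial.coeff r (i : ℕ)) hp
  simpa [p, Polynomial.finsetSum_coeff, Polynomial.coeff_monomial, Fin.val_inj] using this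

/-- Eliminating `q` from the two weak equations gives the local system with the blocks above. -/
theorem weak_iff_local (k : ℕ) {h : ℝ} (hh : 0 < h) (u a : ℤ → Fin (k + 1) → ℂ) :
    (∃ q, WeakAux k h u q ∧ WeakWave k h q a) ↔
      ∀ j, toComplex (massMatrix k h) *ᵥ a j + toComplex (stiffZero k h) *ᵥ u j
        + toComplex (stiffLeft k h) *ᵥ u (j - 1) + toComplex (stiffRight k h) *ᵥ u (j + 1) = 0 := by
  have hU := massMatrix_isUnit_det k hh
  have hl : toComplex (massMatrix k h)⁻¹ * toComplex (massMatrix k h) = 1 := by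
    rw [← toComplex_mul, Matrix.nonsing_inv_mul _ hU, toComplex_one]
  have hr : toComplex (massMatrix k h) * toComplex (massMatrix k h)⁻¹ = 1 := by
    rw [← toComplex_mul, Matrix.mul_nonsing_inv _ hU, toComplex_one]
  have key : ∀ q : ℤ → Fin (k + 1) → ℂ, WeakAux k h u q ↔ q = fun j =>
      toComplex (massMatrix k h)⁻¹ *ᵥ
        (toComplex (auxDiag k h) *ᵥ u j + toComplex (auxLeft k h) *ᵥ u (j - 1)) := by
    intro q
    rw [weakAux_iff, funext_iff]
    refine forall_congr' fun j => ⟨fun e => ?_, fun e => ?_⟩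
    · rw [← e, Matrix.mulVec_mulVec, hl, Matrix.one_mulVec]
    · rw [e, Matrix.mulVec_mulVec, hr, Matrix.one_mulVec]
  simp_rw [key, exists_eq_left, weakWave_iff]
  refine forall_congr' fun j => ?_
  rw [← sub_eq_zero]
  simp only [stiffZero, stiffLeft, stiffRight, toComplex_neg, toComplex_add, toComplex_mul,
    Matrix.neg_mulVec, Matrix.add_mulVec, Matrix.mulVec_add, Matrix.mulVec_mulVec,
    add_sub_cancel_right, Matrix.mul_assoc]
  constructor <;> intro e <;> rw [← e] <;> abel

/-- The weak scheme is the local fully discrete system with these matrices. -/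
theorem isSchemeSolution_iff (k : ℕ) {h : ℝ} (hh : 0 < h) (dt : ℝ)
    (U : ℕ → ℤ → Fin (k + 1) → ℂ) :
    IsSchemeSolution k h dt U ↔ ∀ (n : ℕ) (j : ℤ),
      toComplex (massMatrix k h) *ᵥ
          (((dt : ℂ) ^ 2)⁻¹ • (U (n + 2) j - (2 : ℂ) • U (n + 1) j + U n j))
        + toComplex (stiffZero k h) *ᵥ U (n + 1) j
        + toComplex (stiffLeft k h) *ᵥ U (n + 1) (j - 1)
        + toComplex (stiffRight k h) *ᵥ U (n + 1) (j + 1) = 0 :=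
  forall_congr' fun _ => weak_iff_local k hh _ _

end

end LDG

namespace LDG

noncomputable section

open scoped ComplexOrder
open scoped Topology ContDiff

/-! The two alternating fluxes are dual: by integration by parts the matrix of the second weak
equation is minus the adjoint of that of the first. With `z = e^{-iξh}` the symbol therefore factors
as `K z = (D z)ᴴ M⁻¹ D z`, so it is Hermitian and positive semidefinite. Here `D z v` is the mass
matrix applied to `v'`, plus the jump `l·v - z (r·v)` times the left trace vector `l`.

The decisive fact is that all eigenvalues are simple for `|z| = 1`. If an eigenvector for `s ≠ 0`
has zero jump, energy identities remove both flux terms and leave `v'' = -s v`; differentiation is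
nilpotent on polynomials, so `v = 0`. Hence the scalar jump determines an eigenvector (`simple`).
For `s = 0` the kernel of `D z` consists of constants.

With simple spectrum, the implicit function theorem makes the sorted eigenvalues globally analytic.
For a global eigenvector there are two cases. If some eigenvector on the branch has zero right
trace, a reflection argument shows that it is an eigenvector for every `z`, so the branch is
constant (`eigen_of_r_eq_zero`). Otherwise the right trace never vanishes on the branch, `K - σ M +
r rᵀ` is invertible, and its adjugate applied to `r` is an analytic eigenvector.

At `ξ = 0` the kernel is spanned by the constant `e`. This singles out one branch, and nonnegativity
with simplicity makes the others positive. Expanding the eigenvalue equation to second order around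
`e` gives the curvature `2|z'(0)|² / (e·Me)² = 2h²/h² = 2`. Conjugation shows that `K z` and `K
(star z)` have the same eigenvalues; as they are distinct at `0`, the identity theorem makes every
branch even. -/

/-- Real matrices and vectors (over `ℂ`) describing a differentiation operator `N` with a mass
matrix `M`, boundary functionals `r`, `l` tied to them by summation by parts, a reflection `F`,
and a constant vector `e` spanning the kernel of `N`. -/
structure SummationByParts (ι : Type*) [Fintype ι] [DecidableEq ι] where
  /-- mass matrix -/
  M : Matrix ι ι ℂ
  /-- differentiation -/
  N : Matrix ι ι ℂ
  /-- reflection -/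
  F : Matrix ι ι ℂ
  /-- trace at the right end -/
  r : ι → ℂ
  /-- trace at the left end -/
  l : ι → ℂ
  /-- the constant function `1` -/
  e : ι → ℂ
  posDef : M.PosDef
  nilpotent : IsNilpotent N
  sbp : M * N + Nᴴ * M = Matrix.vecMulVec r r - Matrix.vecMulVec l l
  ker : ∀ v, N *ᵥ v = 0 → ∃ c : ℂ, v = c • e
  N_e : N *ᵥ e = 0
  r_e : r ⬝ᵥ e = 1
  l_e : l ⬝ᵥ e = 1
  star_M : M.map star = M
  star_N : N.map star = N
  star_F : F.map star = F
  star_r : star r = r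
  star_l : star l = l
  star_e : star e = e
  F_r : F *ᵥ r = l
  F_transpose : Fᵀ = F
  F_F : F * F = 1
  F_M : F * M = M * F
  F_N : F * N = -(N * F)

/-! ### Energy identities and simplicity of the spectrum. -/

namespace SummationByParts

variable {ι : Type*} [Fintype ι] [DecidableEq ι] (S : SummationByParts ι)

/-- The jump functional. -/
def jump (z : ℂ) (v : ι → ℂ) : ℂ := S.l ⬝ᵥ v - z * (S.r ⬝ᵥ v)

/-- The discrete derivative, tested (that is, premultiplied by the mass matrix). -/
def D (z : ℂ) : Matrix ι ι ℂ :=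
  S.M * S.N + Matrix.vecMulVec S.l S.l - z • Matrix.vecMulVec S.l S.r

/-- The stiffness matrix. -/
def K (z : ℂ) : Matrix ι ι ℂ := (S.D z)ᴴ * S.M⁻¹ * S.D z

omit [DecidableEq ι] in
theorem vecMulVec_mulVec' (a b v : ι → ℂ) :
    Matrix.vecMulVec a b *ᵥ v = (b ⬝ᵥ v) • a := by
  rw [Matrix.vecMulVec_mulVec]; ext i; simp [mul_comm]

theorem D_mulVec (z : ℂ) (v : ι → ℂ) :
    S.D z *ᵥ v = S.M *ᵥ (S.N *ᵥ v) + S.jump z v • S.l := by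
  simp only [D, jump, Matrix.sub_mulVec, Matrix.add_mulVec, Matrix.smul_mulVec,
    vecMulVec_mulVec', Matrix.mulVec_mulVec]
  module

theorem M_herm : S.Mᴴ = S.M := S.posDef.isHermitian

theorem conjTranspose_D (z : ℂ) :
    (S.D z)ᴴ = -(S.M * S.N) + Matrix.vecMulVec S.r S.r - star z • Matrix.vecMulVec S.r S.l := by
  have h := S.sbp
  simp only [D, Matrix.conjTranspose_sub, Matrix.conjTranspose_add, Matrix.conjTranspose_smul,
    Matrix.conjTranspose_vecMulVec, Matrix.conjTranspose_mul, S.star_r, S.star_l, S.M_herm]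
  rw [eq_sub_of_add_eq' h]
  abel

theorem conjTranspose_D_mulVec (z : ℂ) (q : ι → ℂ) :
    (S.D z)ᴴ *ᵥ q = -(S.M *ᵥ (S.N *ᵥ q)) + (S.r ⬝ᵥ q - star z * (S.l ⬝ᵥ q)) • S.r := by
  simp only [conjTranspose_D, Matrix.sub_mulVec, Matrix.add_mulVec, Matrix.smul_mulVec,
    vecMulVec_mulVec', Matrix.mulVec_mulVec, Matrix.neg_mulVec]
  module

theorem star_dot_r (v : ι → ℂ) : star v ⬝ᵥ S.r = star (S.r ⬝ᵥ v) := by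
  rw [Matrix.star_dotProduct, S.star_r]

theorem star_dot_l (v : ι → ℂ) : star v ⬝ᵥ S.l = star (S.l ⬝ᵥ v) := by
  rw [Matrix.star_dotProduct, S.star_l]

omit [DecidableEq ι] in
theorem star_dot_mulVec (A : Matrix ι ι ℂ) (v w : ι → ℂ) :
    star v ⬝ᵥ (A *ᵥ w) = star (star w ⬝ᵥ (Aᴴ *ᵥ v)) := by
  rw [Matrix.star_dotProduct, Matrix.star_mulVec, Matrix.dotProduct_mulVec]

theorem star_dot_M (v w : ι → ℂ) :
    star v ⬝ᵥ (S.M *ᵥ w) = star (star w ⬝ᵥ (S.M *ᵥ v)) := by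
  rw [star_dot_mulVec, S.M_herm]

/-- The discrete form of `∫ (|v|²)' = |v|²` between the end points; every energy argument below
rests on it. -/
theorem two_mul_re_dot_N (v : ι → ℂ) :
    2 * (star v ⬝ᵥ (S.M *ᵥ (S.N *ᵥ v))).re =
      Complex.normSq (S.r ⬝ᵥ v) - Complex.normSq (S.l ⬝ᵥ v) := by
  have h := congrArg (fun A => star v ⬝ᵥ (A *ᵥ v)) S.sbp
  simp only [Matrix.add_mulVec, Matrix.sub_mulVec, vecMulVec_mulVec', dotProduct_add,
    dotProduct_sub, dotProduct_smul, star_dot_r, star_dot_l, smul_eq_mul] at h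
  rw [star_dot_mulVec (S.Nᴴ * S.M), Matrix.conjTranspose_mul, S.M_herm,
    Matrix.conjTranspose_conjTranspose, ← Matrix.mulVec_mulVec] at h
  have h' := congrArg Complex.re h
  simp only [Complex.add_re, Complex.sub_re, Complex.star_def, Complex.conj_re,
    Complex.mul_conj, Complex.ofReal_re] at h'
  linarith

theorem M_inv_mulVec (v : ι → ℂ) : S.M⁻¹ *ᵥ (S.M *ᵥ v) = v := by
  rw [Matrix.mulVec_mulVec, Matrix.nonsing_inv_mul _ ((Matrix.isUnit_iff_isUnit_det _).1
    S.posDef.isUnit), Matrix.one_mulVec]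

theorem M_mulVec_inv (v : ι → ℂ) : S.M *ᵥ (S.M⁻¹ *ᵥ v) = v := by
  rw [Matrix.mulVec_mulVec, Matrix.mul_nonsing_inv _ ((Matrix.isUnit_iff_isUnit_det _).1
    S.posDef.isUnit), Matrix.one_mulVec]

theorem M_injective {v w : ι → ℂ} (h : S.M *ᵥ v = S.M *ᵥ w) : v = w := by
  rw [← S.M_inv_mulVec v, h, S.M_inv_mulVec]

theorem K_mulVec (z : ℂ) (v : ι → ℂ) :
    S.K z *ᵥ v = (S.D z)ᴴ *ᵥ (S.M⁻¹ *ᵥ (S.D z *ᵥ v)) := by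
  simp [K, Matrix.mulVec_mulVec, Matrix.mul_assoc]

theorem isHermitian_K (z : ℂ) : (S.K z).IsHermitian := by
  have : S.M⁻¹ᴴ = S.M⁻¹ := S.posDef.inv.isHermitian
  simp [K, Matrix.IsHermitian, Matrix.conjTranspose_mul, this, Matrix.mul_assoc]

theorem dot_K (z : ℂ) (v : ι → ℂ) :
    star v ⬝ᵥ (S.K z *ᵥ v) = star (S.D z *ᵥ v) ⬝ᵥ (S.M⁻¹ *ᵥ (S.D z *ᵥ v)) := by
  rw [K_mulVec, Matrix.star_mulVec, Matrix.dotProduct_mulVec]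

theorem posSemidef_K (z : ℂ) : (S.K z).PosSemidef :=
  S.posDef.inv.posSemidef.conjTranspose_mul_mul_same _

/-- A nilpotent operator has no nonzero eigenvalue: iterating gives `N^(2m) v = a^m v`. -/
theorem eq_zero_of_N_N {a : ℂ} (ha : a ≠ 0) {v : ι → ℂ} (h : S.N *ᵥ (S.N *ᵥ v) = a • v) :
    v = 0 := by
  have hp : ∀ m : ℕ, (S.N ^ (2 * m)) *ᵥ v = a ^ m • v := by
    intro m
    induction m with
    | zero => simp
    | succ m ih =>
      rw [mul_add, pow_add, mul_one, pow_two S.N, ← Matrix.mulVec_mulVec, ← Matrix.mulVec_mulVec,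
        h, Matrix.mulVec_smul, ih, smul_smul, pow_succ']
  obtain ⟨m, hm⟩ := S.nilpotent
  have := hp m
  rw [mul_comm, pow_mul, hm] at this
  -- For `m = 0` nilpotency reads `1 = 0`, and every vector vanishes.
  rcases Nat.eq_zero_or_pos m with rfl | hpos
  · have h1 : (1 : Matrix ι ι ℂ) = 0 := by simpa using hm
    rw [← Matrix.one_mulVec v, h1, Matrix.zero_mulVec]
  · rw [zero_pow (by omega), Matrix.zero_mulVec] at this
    exact (smul_eq_zero.1 this.symm).resolve_left (pow_ne_zero _ ha)

variable {S}

/-- The upwind flux is dissipative: for `|z| = 1` the energy identity gives `2 Re (vᴴ D v) =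
|jump|²`. So `D v = 0` forces the jump to vanish, and then `N v = 0`. -/
theorem ker_D {z : ℂ} (hz : ‖z‖ = 1) {v : ι → ℂ} (h : S.D z *ᵥ v = 0) :
    S.jump z v = 0 ∧ ∃ c : ℂ, v = c • S.e := by
  have hz' : Complex.normSq z = 1 := by rw [Complex.normSq_eq_norm_sq, hz]; norm_num
  rw [D_mulVec] at h
  have h1 := congrArg (fun w => (star v ⬝ᵥ w).re) h
  simp only [dotProduct_add, dotProduct_smul, star_dot_l, smul_eq_mul, Complex.add_re,
    dotProduct_zero, Complex.zero_re] at h1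
  have h2 := S.two_mul_re_dot_N v
  have hJ : S.jump z v = 0 := by
    rw [← Complex.normSq_eq_zero]
    unfold jump at h1 ⊢
    generalize S.l ⬝ᵥ v = a at *
    generalize S.r ⬝ᵥ v = b at *
    simp only [Complex.normSq_apply, Complex.star_def, Complex.mul_re, Complex.sub_re,
      Complex.sub_im, Complex.mul_im, Complex.conj_re, Complex.conj_im] at *
    linear_combination 2 * h1 - h2 + (b.re * b.re + b.im * b.im) * hz'
  refine ⟨hJ, S.ker v (S.M_injective ?_)⟩
  rw [hJ, zero_smul, add_zero] at h
  rw [h, Matrix.mulVec_zero]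

/-- Without a jump, `q = N v`. Pairing the eigenvalue equation with `q`, its right side has real
part `s (|r·v|² - |l·v|²)/2 = 0`, because `l·v = z (r·v)`. The left side has real part half the
squared modulus of the jump of `q`, so that jump vanishes too, leaving `N (N v) = -s v`. -/
theorem eq_zero_of_jump_eq_zero {z : ℂ} (hz : ‖z‖ = 1) {s : ℝ} (hs : s ≠ 0) {v : ι → ℂ}
    (h : S.K z *ᵥ v = (s : ℂ) • (S.M *ᵥ v)) (hJ : S.jump z v = 0) : v = 0 := by
  have hz' : Complex.normSq z = 1 := by rw [Complex.normSq_eq_norm_sq, hz]; norm_num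
  set q := S.N *ᵥ v with hq
  rw [K_mulVec, D_mulVec, hJ, zero_smul, add_zero, M_inv_mulVec, conjTranspose_D_mulVec,
    ← hq] at h
  have h1 := congrArg (fun w => (star q ⬝ᵥ w).re) h
  simp only [dotProduct_add, dotProduct_neg, dotProduct_smul, star_dot_r, smul_eq_mul,
    Complex.add_re, Complex.neg_re, Complex.re_ofReal_mul] at h1
  have h2 := S.two_mul_re_dot_N q
  have h3 := S.two_mul_re_dot_N v
  rw [star_dot_M, ← hq] at h3
  have h4 : S.l ⬝ᵥ v = z * (S.r ⬝ᵥ v) := sub_eq_zero.1 hJ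
  rw [h4, Complex.normSq_mul, hz', one_mul, sub_self] at h3
  have h5 : (star q ⬝ᵥ (S.M *ᵥ v)).re = 0 := by
    simp only [Complex.star_def, Complex.conj_re] at h3
    linarith
  have h6 : S.r ⬝ᵥ q - star z * (S.l ⬝ᵥ q) = 0 := by
    rw [← Complex.normSq_eq_zero]
    rw [h5] at h1
    generalize S.l ⬝ᵥ q = a at *
    generalize S.r ⬝ᵥ q = b at *
    simp only [Complex.normSq_apply, Complex.star_def, Complex.mul_re, Complex.sub_re,
      Complex.sub_im, Complex.mul_im, Complex.conj_re, Complex.conj_im] at *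
    linear_combination 2 * h1 + h2 + (a.re * a.re + a.im * a.im) * hz'
  rw [h6, zero_smul, add_zero, ← Matrix.mulVec_neg, ← Matrix.mulVec_smul] at h
  have h7 := S.M_injective h
  refine S.eq_zero_of_N_N (a := -(s : ℂ)) (by simpa using hs) ?_
  rw [← hq, neg_smul, ← h7, neg_neg]

theorem jump_smul_sub (z a b : ℂ) (v w : ι → ℂ) :
    S.jump z (a • v - b • w) = a * S.jump z v - b * S.jump z w := by
  simp only [jump, dotProduct_sub, dotProduct_smul, smul_eq_mul]; ring

theorem D_eq_zero_of_K {z : ℂ} {v : ι → ℂ} (h : S.K z *ᵥ v = 0) : S.D z *ᵥ v = 0 := by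
  have h1 := S.dot_K z v
  rw [h, dotProduct_zero] at h1
  by_contra hne
  exact (S.posDef.inv.dotProduct_mulVec_pos hne).ne h1

/-- All eigenvalues are simple. -/
theorem simple {z : ℂ} (hz : ‖z‖ = 1) {s : ℝ} {v w : ι → ℂ}
    (hv : S.K z *ᵥ v = (s : ℂ) • (S.M *ᵥ v)) (hw : S.K z *ᵥ w = (s : ℂ) • (S.M *ᵥ w))
    (hv0 : v ≠ 0) : ∃ c : ℂ, w = c • v := by
  by_cases hs : s = 0
  · simp only [hs, Complex.ofReal_zero, zero_smul] at hv hw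
    obtain ⟨-, a, rfl⟩ := ker_D hz (D_eq_zero_of_K hv)
    obtain ⟨-, b, rfl⟩ := ker_D hz (D_eq_zero_of_K hw)
    have ha : a ≠ 0 := by rintro rfl; simp at hv0
    exact ⟨b / a, by rw [smul_smul, div_mul_cancel₀ _ ha]⟩
  · have hJ : S.jump z v ≠ 0 := fun h => hv0 (eq_zero_of_jump_eq_zero hz hs hv h)
    -- This combination of the two eigenvectors is built to have zero jump.
    have := eq_zero_of_jump_eq_zero (v := S.jump z v • w - S.jump z w • v) hz hs (by
      rw [Matrix.mulVec_sub, Matrix.mulVec_smul, Matrix.mulVec_smul, hv, hw, Matrix.mulVec_sub,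
        Matrix.mulVec_smul, Matrix.mulVec_smul]
      module) (by rw [jump_smul_sub]; ring)
    refine ⟨S.jump z w / S.jump z v, ?_⟩
    rw [sub_eq_zero] at this
    rw [div_eq_inv_mul, mul_smul, ← this, smul_smul, inv_mul_cancel₀ hJ, one_smul]

/-! ### Conjugation, reflection and branches that do not depend on the Bloch factor. -/

omit [DecidableEq ι] in
theorem star_mulVec_map (A : Matrix ι ι ℂ) (v : ι → ℂ) :
    star (A *ᵥ v) = A.map star *ᵥ star v := by
  ext i; simp [Matrix.mulVec, dotProduct]

theorem jump_star (z : ℂ) (v : ι → ℂ) : star (S.jump z v) = S.jump (star z) (star v) := by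
  simp only [jump, star_sub, star_mul']
  rw [dotProduct_comm S.l (star v), dotProduct_comm S.r (star v), star_dot_l,
    star_dot_r]

theorem dot_F (a v : ι → ℂ) : a ⬝ᵥ (S.F *ᵥ v) = (S.F *ᵥ a) ⬝ᵥ v := by
  rw [Matrix.dotProduct_mulVec, ← Matrix.mulVec_transpose, S.F_transpose]

theorem F_l : S.F *ᵥ S.l = S.r := by
  rw [← S.F_r, Matrix.mulVec_mulVec, S.F_F, Matrix.one_mulVec]

theorem D_star (z : ℂ) (v : ι → ℂ) : star (S.D z *ᵥ v) = S.D (star z) *ᵥ star v := by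
  rw [D_mulVec, D_mulVec, star_add, star_smul, jump_star, star_mulVec_map, star_mulVec_map,
    S.star_M, S.star_N, S.star_l]

theorem M_F (v : ι → ℂ) : S.M *ᵥ (S.F *ᵥ v) = S.F *ᵥ (S.M *ᵥ v) := by
  rw [Matrix.mulVec_mulVec, ← S.F_M, ← Matrix.mulVec_mulVec]

theorem N_F (v : ι → ℂ) : S.N *ᵥ (S.F *ᵥ v) = -(S.F *ᵥ (S.N *ᵥ v)) := by
  rw [Matrix.mulVec_mulVec, Matrix.mulVec_mulVec, S.F_N, Matrix.neg_mulVec, neg_neg]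

/-- Reflection turns the discrete derivative into its adjoint, up to complex conjugation. -/
theorem D_F_star (z : ℂ) (q : ι → ℂ) :
    S.D z *ᵥ (S.F *ᵥ star q) = S.F *ᵥ star ((S.D z)ᴴ *ᵥ q) := by
  rw [D_mulVec, conjTranspose_D_mulVec, N_F, Matrix.mulVec_neg, M_F, star_add, star_neg, star_smul,
    star_mulVec_map, star_mulVec_map, S.star_M, S.star_N, S.star_r, Matrix.mulVec_add,
    Matrix.mulVec_neg, Matrix.mulVec_smul, S.F_r]
  congr 2
  simp only [jump, dot_F, F_l, S.F_r, star_sub, star_mul', star_star]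
  rw [dotProduct_comm S.l (star q), dotProduct_comm S.r (star q), star_dot_l,
    star_dot_r]

theorem conjTranspose_D_F_star (z : ℂ) (v : ι → ℂ) :
    (S.D z)ᴴ *ᵥ (S.F *ᵥ star v) = S.F *ᵥ star (S.D z *ᵥ v) := by
  rw [D_mulVec, conjTranspose_D_mulVec, N_F, Matrix.mulVec_neg, M_F, star_add, star_smul,
    star_mulVec_map, star_mulVec_map, S.star_M, S.star_N, S.star_l, Matrix.mulVec_add,
    Matrix.mulVec_smul, F_l, neg_neg]
  congr 2
  simp only [jump, dot_F, F_l, S.F_r, star_sub, star_mul']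
  rw [dotProduct_comm S.l (star v), dotProduct_comm S.r (star v), star_dot_l,
    star_dot_r]

/-- An eigenvector with vanishing right trace is an eigenvector for every `z`. -/
theorem eigen_of_r_eq_zero {z : ℂ} (hz : ‖z‖ = 1) {s : ℝ} {v : ι → ℂ}
    (hv : S.K z *ᵥ v = (s : ℂ) • (S.M *ᵥ v)) (hv0 : v ≠ 0) (hr : S.r ⬝ᵥ v = 0) (z' : ℂ) :
    S.K z' *ᵥ v = (s : ℂ) • (S.M *ᵥ v) := by
  set q := S.M⁻¹ *ᵥ (S.D z *ᵥ v) with hq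
  have hMq : S.M *ᵥ q = S.D z *ᵥ v := S.M_mulVec_inv _
  have hDq : (S.D z)ᴴ *ᵥ q = (s : ℂ) • (S.M *ᵥ v) := by rw [← hv, K_mulVec]
  -- Reflection with conjugation exchanges `D z` and its adjoint, hence the roles of `v` and `q`:
  -- the reflected `q` solves the same eigenvalue problem, and by simplicity it is a multiple of
  -- `v`.
  have hu : S.K z *ᵥ (S.F *ᵥ star q) = (s : ℂ) • (S.M *ᵥ (S.F *ᵥ star q)) := by
    rw [K_mulVec, D_F_star, hDq, star_smul, star_mulVec_map, S.star_M, Matrix.mulVec_smul, ← M_F,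
      Matrix.mulVec_smul, M_inv_mulVec, Matrix.mulVec_smul, conjTranspose_D_F_star, ← hMq,
      star_mulVec_map, S.star_M, ← M_F]
    simp
  obtain ⟨c, hc⟩ := simple hz hv hu hv0
  have hl : S.l ⬝ᵥ q = 0 := by
    have h1 : S.r ⬝ᵥ (S.F *ᵥ star q) = 0 := by rw [hc, dotProduct_smul, hr, smul_zero]
    rw [dot_F, S.F_r, dotProduct_comm, star_dot_l] at h1
    simpa using h1
  -- The Bloch factor enters only through `r·v` in `D z v` and through `l·q` in the adjoint; both
  -- are zero.
  have hD : S.D z' *ᵥ v = S.M *ᵥ q := by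
    rw [hMq, D_mulVec, D_mulVec, jump, jump, hr, mul_zero, mul_zero]
  rw [K_mulVec, hD, M_inv_mulVec, ← hDq, conjTranspose_D_mulVec, conjTranspose_D_mulVec, hl,
    mul_zero, mul_zero]

end SummationByParts

/-! ### The monomial basis as a summation-by-parts structure. -/

theorem basisFun_zero_apply (h : ℝ) (l : ℕ) (x : ℝ) : basisFun h 0 l x = (x / (h / 2)) ^ l := by
  simp [basisFun]

theorem hasDerivAt_basisFun (h : ℝ) (l : ℕ) (x : ℝ) :
    HasDerivAt (basisFun h 0 l) (l * (2 / h) * basisFun h 0 (l - 1) x) x := by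
  have : basisFun h 0 l = fun x => (x / (h / 2)) ^ l := funext (basisFun_zero_apply h l)
  rw [this, basisFun_zero_apply]
  convert! ((hasDerivAt_id x).div_const (h / 2)).pow l using 1
  simp only [id]
  rw [one_div_div]
  ring

theorem rightTrace_eq (k : ℕ) {h : ℝ} (hh : 0 < h) (l : Fin (k + 1)) : rightTrace k h l = 1 := by
  rw [rightTrace, basisFun_zero_apply, div_self (by positivity), one_pow]

theorem leftTrace_eq (k : ℕ) {h : ℝ} (hh : 0 < h) (l : Fin (k + 1)) :
    leftTrace k h l = (-1) ^ (l : ℕ) := by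
  rw [leftTrace, basisFun_zero_apply, neg_div, div_self (by positivity)]

/-- The matrix of `d/dx` on polynomials of degree at most `k`. -/
def diffMatrix (k : ℕ) (h : ℝ) : Matrix (Fin (k + 1)) (Fin (k + 1)) ℝ :=
  Matrix.of fun l m => if (l : ℕ) + 1 = m then m * (2 / h) else 0

/-- The matrix of the reflection `x ↦ -x`. -/
def flipMatrix (k : ℕ) : Matrix (Fin (k + 1)) (Fin (k + 1)) ℝ :=
  Matrix.diagonal fun l => (-1) ^ (l : ℕ)

theorem massMatrix_mul_diffMatrix (k : ℕ) (h : ℝ) :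
    massMatrix k h * diffMatrix k h = (derivMatrix k h)ᵀ := by
  ext l m
  simp only [Matrix.mul_apply, massMatrix, diffMatrix, derivMatrix, Matrix.transpose_apply,
    Matrix.of_apply, (hasDerivAt_basisFun h _ _).deriv]
  rcases Nat.eq_zero_or_pos (m : ℕ) with hm | hm
  · simp [hm]
  · rw [Finset.sum_eq_single (⟨m - 1, by omega⟩ : Fin (k + 1))]
    · rw [if_pos (by simp; omega), mul_comm, ← intervalIntegral.integral_const_mul]
      congr 1; ext x; ring
    · intro b _ hb
      rw [if_neg, mul_zero]
      intro hbm
      exact hb (Fin.ext (by simp; omega))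
    · simp

theorem derivMatrix_add_transpose (k : ℕ) (h : ℝ) :
    derivMatrix k h + (derivMatrix k h)ᵀ =
      Matrix.vecMulVec (rightTrace k h) (rightTrace k h)
        - Matrix.vecMulVec (leftTrace k h) (leftTrace k h) := by
  ext l m
  simp only [Matrix.add_apply, Matrix.sub_apply, derivMatrix, Matrix.transpose_apply,
    Matrix.of_apply, Matrix.vecMulVec_apply, rightTrace, leftTrace]
  have hi := fun i : ℕ => fun x : ℝ => (hasDerivAt_basisFun h i x).differentiableAt.hasDerivAt
  rw [← intervalIntegral.integral_deriv_mul_eq_sub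
    (u := basisFun h 0 l) (v := basisFun h 0 m) (fun x _ => hi _ x) (fun x _ => hi _ x)
    ((continuous_deriv_basisFun h 0 l).intervalIntegrable _ _)
    ((continuous_deriv_basisFun h 0 m).intervalIntegrable _ _),
    ← intervalIntegral.integral_add]
  · congr 1; ext x; ring
  · exact ((continuous_basisFun h 0 _).mul (continuous_deriv_basisFun h 0 _)).intervalIntegrable _ _
  · exact ((continuous_basisFun h 0 _).mul (continuous_deriv_basisFun h 0 _)).intervalIntegrable _ _

theorem diffMatrix_pow_apply (k : ℕ) (h : ℝ) (p : ℕ) (l m : Fin (k + 1))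
    (hlm : (l : ℕ) + p ≠ m) : (diffMatrix k h ^ p) l m = 0 := by
  induction p generalizing m with
  | zero => simp only [pow_zero]; exact Matrix.one_apply_ne fun e => hlm (by simp [e])
  | succ p ih =>
    rw [pow_succ, Matrix.mul_apply]
    refine Finset.sum_eq_zero fun j _ => ?_
    by_cases hj : (l : ℕ) + p = j
    · rw [diffMatrix, Matrix.of_apply, if_neg (by omega), mul_zero]
    · rw [ih j hj, zero_mul]

theorem isNilpotent_diffMatrix (k : ℕ) (h : ℝ) : IsNilpotent (diffMatrix k h) :=
  ⟨k + 1, by ext l m; exact diffMatrix_pow_apply k h _ l m (by omega)⟩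

theorem flipMatrix_mul_massMatrix (k : ℕ) (h : ℝ) :
    flipMatrix k * massMatrix k h = massMatrix k h * flipMatrix k := by
  ext l m
  simp only [flipMatrix, Matrix.diagonal_mul, Matrix.mul_diagonal, massMatrix, Matrix.of_apply]
  have hneg : ∀ (i : ℕ) (x : ℝ), basisFun h 0 i (-x) = (-1) ^ i * basisFun h 0 i x := by
    intro i x
    rw [basisFun_zero_apply, basisFun_zero_apply, neg_div, neg_pow]
  have h1 := intervalIntegral.integral_comp_neg (a := -(h / 2)) (b := h / 2)
    (fun x => basisFun h 0 l x * basisFun h 0 m x)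
  rw [neg_neg] at h1
  rw [← h1, mul_comm _ ((-1 : ℝ) ^ (m : ℕ)), ← intervalIntegral.integral_const_mul]
  conv_rhs => rw [h1]
  rw [← intervalIntegral.integral_const_mul]
  congr 1; ext x
  rw [hneg, hneg]
  have := pow_mul_pow_eq_one (M := ℝ) (l : ℕ) (show (-1 : ℝ) * (-1) = 1 by norm_num)
  linear_combination ((-1) ^ (m : ℕ) * basisFun h 0 l x * basisFun h 0 m x) * this

theorem flipMatrix_mul_diffMatrix (k : ℕ) (h : ℝ) :
    flipMatrix k * diffMatrix k h = -(diffMatrix k h * flipMatrix k) := by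
  ext l m
  simp only [flipMatrix, Matrix.diagonal_mul, Matrix.neg_apply, Matrix.mul_diagonal, diffMatrix,
    Matrix.of_apply]
  split_ifs with hlm
  · rw [← hlm, pow_succ]; ring
  · simp

/-- The quadratic form is `∫ |u|² ≥ 0`; definiteness then follows from the nonzero determinant of
the real mass matrix. -/
theorem posDef_toComplex_massMatrix (k : ℕ) {h : ℝ} (hh : 0 < h) :
    (toComplex (massMatrix k h)).PosDef := by
  have hpsd : (toComplex (massMatrix k h)).PosSemidef := by
    refine Matrix.PosSemidef.of_dotProduct_mulVec_nonneg ?_ fun c => ?_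
    · ext l m
      simp [toComplex, massMatrix, Matrix.conjTranspose_apply, mul_comm]
    · rw [← integral_mass k h 0 c (star c)]
      have e : ∀ x, cellPoly k h 0 c x * cellPoly k h 0 (star c) x =
          ((Complex.normSq (cellPoly k h 0 c x) : ℝ) : ℂ) := by
        intro x
        rw [← Complex.mul_conj]
        simp [cellPoly, map_sum]
      simp_rw [e]
      rw [intervalIntegral.integral_ofReal]
      have h1 : node h (0 - 1) ≤ node h 0 := by rw [node_sub_one, node_eq]; simp; linarith
      exact_mod_cast intervalIntegral.integral_nonneg h1 fun x _ => Complex.normSq_nonneg _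
  rw [hpsd.posDef_iff_det_ne_zero]
  have := (massMatrix_isUnit_det k hh).ne_zero
  have h2 : (toComplex (massMatrix k h)).det = ((massMatrix k h).det : ℂ) :=
    (RingHom.map_det Complex.ofRealHom _).symm
  rw [h2]
  exact_mod_cast this

theorem conjTranspose_toComplex {k : ℕ} (A : Matrix (Fin (k + 1)) (Fin (k + 1)) ℝ) :
    (toComplex A)ᴴ = toComplex Aᵀ := by
  ext; simp [toComplex]

theorem map_star_toComplex {k : ℕ} (A : Matrix (Fin (k + 1)) (Fin (k + 1)) ℝ) :
    (toComplex A).map star = toComplex A := by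
  ext; simp [toComplex]

theorem toComplex_vecMulVec {k : ℕ} (a b : Fin (k + 1) → ℝ) :
    toComplex (Matrix.vecMulVec a b) =
      Matrix.vecMulVec (fun i => (a i : ℂ)) (fun i => (b i : ℂ)) := by
  ext; simp [toComplex, Matrix.vecMulVec_apply]

theorem toComplex_pow {k : ℕ} (A : Matrix (Fin (k + 1)) (Fin (k + 1)) ℝ) (n : ℕ) :
    toComplex (A ^ n) = toComplex A ^ n :=
  map_pow (Complex.ofRealHom.mapMatrix) A n

theorem toComplex_inv {k : ℕ} {A : Matrix (Fin (k + 1)) (Fin (k + 1)) ℝ} (hA : IsUnit A.det) :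
    toComplex A⁻¹ = (toComplex A)⁻¹ := by
  symm
  apply Matrix.inv_eq_left_inv
  rw [← toComplex_mul, Matrix.nonsing_inv_mul _ hA, toComplex_one]

theorem diffMatrix_mulVec_castSucc (k : ℕ) (h : ℝ) (v : Fin (k + 1) → ℂ) (i : Fin k) :
    (toComplex (diffMatrix k h) *ᵥ v) i.castSucc = ((i : ℕ) + 1) * (2 / h) * v i.succ := by
  simp only [Matrix.mulVec, dotProduct, toComplex, Matrix.map_apply, diffMatrix, Matrix.of_apply]
  rw [Finset.sum_eq_single i.succ]
  · simp
  · intro b _ hb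
    rw [if_neg]
    · simp
    · intro e; exact hb (Fin.ext (by simpa using e.symm))
  · simp

/-- The summation-by-parts structure of the monomial basis. -/
def sbp (k : ℕ) (h : ℝ) (hh : 0 < h) : SummationByParts (Fin (k + 1)) where
  M := toComplex (massMatrix k h)
  N := toComplex (diffMatrix k h)
  F := toComplex (flipMatrix k)
  r := fun l => (rightTrace k h l : ℂ)
  l := fun l => (leftTrace k h l : ℂ)
  e := Pi.single 0 1
  posDef := posDef_toComplex_massMatrix k hh
  nilpotent := by
    obtain ⟨n, hn⟩ := isNilpotent_diffMatrix k h
    exact ⟨n, by rw [← toComplex_pow, hn]; ext; simp [toComplex]⟩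
  sbp := by
    have hM : massMatrix k h = (massMatrix k h)ᵀ := by
      ext; simp [massMatrix, mul_comm]
    have hN : (diffMatrix k h)ᵀ * massMatrix k h = derivMatrix k h := by
      conv_lhs => rw [hM]
      rw [← Matrix.transpose_mul, massMatrix_mul_diffMatrix, Matrix.transpose_transpose]
    rw [conjTranspose_toComplex, ← toComplex_mul, ← toComplex_mul, ← toComplex_vecMulVec,
      ← toComplex_vecMulVec, ← toComplex_sub, ← toComplex_add, massMatrix_mul_diffMatrix, hN,
      ← derivMatrix_add_transpose, add_comm (derivMatrix k h)]
  ker := by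
    intro v hv
    refine ⟨v 0, ?_⟩
    ext i
    induction i using Fin.cases with
    | zero => simp
    | succ i =>
      have h1 := congrFun hv i.castSucc
      rw [diffMatrix_mulVec_castSucc] at h1
      have h2 : ((i : ℕ) + 1 : ℂ) ≠ 0 := by exact_mod_cast Nat.succ_ne_zero i
      have h3 : (2 / h : ℂ) ≠ 0 := by
        have : (h : ℂ) ≠ 0 := by exact_mod_cast hh.ne'
        positivity
      simpa [h2, h3, hh.ne'] using h1
  N_e := by
    ext l
    simp [toComplex, diffMatrix]
  r_e := by simp [rightTrace_eq k hh]
  l_e := by simp [leftTrace_eq k hh]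
  star_M := map_star_toComplex _
  star_N := map_star_toComplex _
  star_F := map_star_toComplex _
  star_r := by ext; simp
  star_l := by ext; simp
  star_e := by
    ext i
    by_cases hi : i = 0
    · subst hi; simp
    · simp [hi]
  F_r := by
    ext i
    simp only [toComplex, flipMatrix, Matrix.diagonal_map Complex.ofReal_zero,
      Matrix.mulVec_diagonal, rightTrace_eq k hh, leftTrace_eq k hh]
    simp
  F_transpose := by
    simp [toComplex, flipMatrix, Matrix.diagonal_map]
  F_F := by
    rw [← toComplex_mul, flipMatrix, Matrix.diagonal_mul_diagonal, ← toComplex_one]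
    congr 1
    rw [← Matrix.diagonal_one]
    congr 1; ext i
    rw [← mul_pow]; simp
  F_M := by rw [← toComplex_mul, flipMatrix_mul_massMatrix, toComplex_mul]
  F_N := by rw [← toComplex_mul, flipMatrix_mul_diffMatrix, toComplex_neg, toComplex_mul]

/-! ### The Bloch factor and the factorization of the symbol. -/

/-- The Bloch factor `e^{-iξh}`. -/
def bloch (h ξ : ℝ) : ℂ := Complex.exp (-(Complex.I * (ξ : ℂ) * (h : ℂ)))

theorem star_bloch (h ξ : ℝ) : star (bloch h ξ) = Complex.exp (Complex.I * (ξ : ℂ) * (h : ℂ)) := by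
  rw [bloch, Complex.star_def, ← Complex.exp_conj]
  simp

theorem norm_bloch (h ξ : ℝ) : ‖bloch h ξ‖ = 1 := by
  rw [bloch, Complex.norm_exp]
  simp

theorem bloch_neg (h ξ : ℝ) : bloch h (-ξ) = star (bloch h ξ) := by
  rw [star_bloch, bloch]; simp

theorem bloch_zero (h : ℝ) : bloch h 0 = 1 := by simp [bloch]

/-- Integration by parts moves the derivative from the test function to the trial function, which
trades the right trace term for a left one. -/
theorem auxDiag_eq (k : ℕ) (h : ℝ) : auxDiag k h = massMatrix k h * diffMatrix k h
    + Matrix.vecMulVec (leftTrace k h) (leftTrace k h) := by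
  rw [massMatrix_mul_diffMatrix, auxDiag, eq_sub_of_add_eq' (derivMatrix_add_transpose k h)]
  abel

theorem waveDiag_eq (k : ℕ) (h : ℝ) : waveDiag k h = -(-(massMatrix k h * diffMatrix k h)
    + Matrix.vecMulVec (rightTrace k h) (rightTrace k h)) := by
  rw [massMatrix_mul_diffMatrix, waveDiag, eq_sub_of_add_eq' (derivMatrix_add_transpose k h)]
  abel

/-- The first weak equation has symbol `D z`, the second `-(D z)ᴴ`. In the product the cross term of
`waveRight` and `auxLeft` carries `z * star z = 1`, which is why it belongs to `stiffZero`. -/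
theorem symbol_eq (k : ℕ) (h : ℝ) (hh : 0 < h) (ξ : ℝ) :
    symbol k h ξ = (sbp k h hh).K (bloch h ξ) := by
  have hz : bloch h ξ * star (bloch h ξ) = 1 := by
    rw [Complex.star_def, Complex.mul_conj, Complex.normSq_eq_norm_sq, norm_bloch]; simp
  have hD : (sbp k h hh).D (bloch h ξ) =
      toComplex (auxDiag k h) + bloch h ξ • toComplex (auxLeft k h) := by
    rw [auxDiag_eq, auxLeft, toComplex_add, toComplex_mul, toComplex_neg, toComplex_vecMulVec,
      toComplex_vecMulVec, smul_neg, ← sub_eq_add_neg]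
    rfl
  have hDs : ((sbp k h hh).D (bloch h ξ))ᴴ =
      -(toComplex (waveDiag k h) + star (bloch h ξ) • toComplex (waveRight k h)) := by
    rw [SummationByParts.conjTranspose_D, waveDiag_eq, waveRight, toComplex_neg, toComplex_add,
      toComplex_neg, toComplex_mul, toComplex_vecMulVec, toComplex_vecMulVec, neg_add, neg_neg,
      ← sub_eq_add_neg]
    rfl
  rw [SummationByParts.K, hDs, hD, symbol, ← star_bloch, ← bloch]
  have hM : (sbp k h hh).M⁻¹ = toComplex (massMatrix k h)⁻¹ :=
    (toComplex_inv (massMatrix_isUnit_det k hh)).symm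
  rw [hM]
  simp only [stiffZero, stiffLeft, stiffRight, toComplex_neg, toComplex_add, toComplex_mul]
  simp only [neg_mul, add_mul, mul_add, Matrix.smul_mul, Matrix.mul_smul, smul_smul, hz,
    one_smul, smul_neg, neg_add]
  abel

/-! ### Analytic eigenvalues of Hermitian families with simple spectrum. -/

/-- A strictly monotone enumeration of a finite set is unique, and an injection of `Fin n` into
itself is onto; this identifies local analytic roots with the sorted ones. -/
theorem strictAnti_eq_of_mem_range {n : ℕ} {f g : Fin n → ℝ} (hf : StrictAnti f)
    (hg : StrictAnti g) (h : ∀ i, ∃ j, f i = g j) : f = g := by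
  rw [← StrictAnti.range_inj hf hg]
  choose τ hτ using h
  have hinj : Function.Injective τ := fun a b hab => hf.injective (by rw [hτ, hτ, hab])
  have hsurj := Finite.surjective_of_injective hinj
  ext x
  constructor
  · rintro ⟨i, rfl⟩; exact ⟨τ i, (hτ i).symm⟩
  · rintro ⟨j, rfl⟩
    obtain ⟨i, rfl⟩ := hsurj j
    exact ⟨i, hτ i⟩

/-- The sorted roots of a monic real-rooted polynomial with simple roots, depending analytically on
a parameter, are analytic. -/
theorem analyticAt_sorted_roots {n : ℕ} (G : ℝ × ℝ → ℝ) (hG : ∀ u, AnalyticAt ℝ G u)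
    (lam : ℝ → Fin n → ℝ) (hlam : ∀ ξ, StrictAnti (lam ξ))
    (hprod : ∀ ξ t, G (ξ, t) = ∏ i, (t - lam ξ i)) (i : Fin n) (ξ₀ : ℝ) :
    AnalyticAt ℝ (fun ξ => lam ξ i) ξ₀ := by
  -- The derivative in `t` at the root `lam ξ₀ j` is the product of its differences to the other
  -- roots, nonzero because the roots are distinct.
  have hinv : ∀ j, (fderiv ℝ G (ξ₀, lam ξ₀ j) ∘L .inr ℝ ℝ ℝ).IsInvertible := by
    intro j
    have h1 : HasFDerivAt (fun t : ℝ => G (ξ₀, t))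
        (fderiv ℝ G (ξ₀, lam ξ₀ j) ∘L .inr ℝ ℝ ℝ) (lam ξ₀ j) :=
      (hG (ξ₀, lam ξ₀ j)).differentiableAt.hasFDerivAt.comp (lam ξ₀ j)
        (hasFDerivAt_prodMk_right ξ₀ (lam ξ₀ j))
    have h2 : HasDerivAt (fun t : ℝ => G (ξ₀, t))
        (∏ i ∈ Finset.univ.erase j, (lam ξ₀ j - lam ξ₀ i)) (lam ξ₀ j) := by
      simp_rw [hprod]
      convert! HasDerivAt.fun_finsetProd (u := Finset.univ) (f := fun i t => t - lam ξ₀ i)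
        (f' := fun _ => (1 : ℝ)) (x := lam ξ₀ j) (fun i _ => (hasDerivAt_id _).sub_const _) using 1
      rw [Finset.sum_eq_single j]
      · simp
      · intro b _ hb
        rw [Finset.prod_eq_zero (i := j) (by simp [hb.symm]) (by simp), zero_smul]
      · simp
    have h3 : (fderiv ℝ G (ξ₀, lam ξ₀ j) ∘L .inr ℝ ℝ ℝ) 1 ≠ 0 := by
      have h4 := h1.hasDerivAt.unique h2
      rw [h4]
      refine Finset.prod_ne_zero_iff.2 fun b hb => sub_ne_zero.2 fun e => ?_
      exact (Finset.ne_of_mem_erase hb) ((hlam ξ₀).injective e).symm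
    set A := fderiv ℝ G (ξ₀, lam ξ₀ j) ∘L .inr ℝ ℝ ℝ
    refine ⟨ContinuousLinearEquiv.unitsEquivAut ℝ (Units.mk0 (A 1) h3), ?_⟩
    ext
    simp
  have hcd : ∀ j, ContDiffAt ℝ ω G (ξ₀, lam ξ₀ j) := fun j => (hG _).contDiffAt
  let s : Fin n → ℝ → ℝ := fun j => (hcd j).implicitFunction (by simp) (hinv j)
  have hs : ∀ j, AnalyticAt ℝ (s j) ξ₀ := fun j =>
    ((hcd j).contDiffAt_implicitFunction (by simp) (hinv j)).analyticAt
  have hs0 : ∀ j, s j ξ₀ = lam ξ₀ j := fun j =>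
    (hcd j).implicitFunction_apply_self (by simp) (hinv j)
  have hroot : ∀ j, ∀ᶠ ξ in 𝓝 ξ₀, ∃ m, s j ξ = lam ξ m := by
    intro j
    filter_upwards [(hcd j).eventually_apply_implicitFunction (by simp) (hinv j)] with ξ hξ
    have h0 : ∏ i, (lam ξ₀ j - lam ξ₀ i) = 0 :=
      Finset.prod_eq_zero (Finset.mem_univ j) (sub_self _)
    rw [hprod, hprod, h0, Finset.prod_eq_zero_iff] at hξ
    obtain ⟨m, -, hm⟩ := hξ
    exact ⟨m, sub_eq_zero.1 hm⟩
  -- The implicit solutions keep their order near `ξ₀` by continuity, so they are all the roots,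
  -- already sorted.
  have hanti : ∀ᶠ ξ in 𝓝 ξ₀, StrictAnti fun j => s j ξ := by
    have : ∀ᶠ ξ in 𝓝 ξ₀, ∀ a b, a < b → s b ξ < s a ξ := by
      rw [Filter.eventually_all]; intro a
      rw [Filter.eventually_all]; intro b
      by_cases hab : a < b
      · have h0 : s b ξ₀ < s a ξ₀ := by rw [hs0, hs0]; exact hlam ξ₀ hab
        filter_upwards [(hs b).continuousAt.eventually_lt (hs a).continuousAt h0] with ξ hξ _ using hξ
      · exact Filter.Eventually.of_forall fun ξ h => absurd h hab
    filter_upwards [this] with ξ hξ a b hab using hξ a b hab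
  refine (hs i).congr ?_
  filter_upwards [hanti, Filter.eventually_all.2 hroot] with ξ h1 h2
  exact congrFun (strictAnti_eq_of_mem_range h1 (hlam ξ) h2) i

theorem analyticAt_det {ι E : Type*} [Fintype ι] [DecidableEq ι] [NormedAddCommGroup E]
    [NormedSpace ℝ E] {A : E → Matrix ι ι ℂ} {x : E}
    (hA : ∀ i j, AnalyticAt ℝ (fun y => A y i j) x) : AnalyticAt ℝ (fun y => (A y).det) x := by
  simp only [Matrix.det_apply']
  refine Finset.analyticAt_fun_sum _ fun τ _ => ?_
  exact analyticAt_const.mul (Finset.analyticAt_fun_prod _ fun i _ => hA _ _)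

/-- Rellich's theorem for analytic families of Hermitian matrices with simple spectrum. -/
theorem exists_analytic_eigenvalues {n : ℕ} (H : ℝ → Matrix (Fin n) (Fin n) ℂ)
    (hH : ∀ ξ i j, AnalyticAt ℝ (fun ξ => H ξ i j) ξ) (herm : ∀ ξ, (H ξ).IsHermitian)
    (simple : ∀ ξ (t : ℝ) (v w : Fin n → ℂ), H ξ *ᵥ v = (t : ℂ) • v → H ξ *ᵥ w = (t : ℂ) • w →
      v ≠ 0 → ∃ c : ℂ, w = c • v) :
    ∃ σ : Fin n → ℝ → ℝ, (∀ i ξ, AnalyticAt ℝ (σ i) ξ) ∧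
      (∀ ξ, Function.Injective fun i => σ i ξ) ∧
      ∀ i ξ, ∃ v : Fin n → ℂ, v ≠ 0 ∧ H ξ *ᵥ v = (σ i ξ : ℂ) • v := by
  have hcard := Fintype.card_fin n
  have hev : ∀ ξ i, ∃ v : Fin n → ℂ, v ≠ 0 ∧ H ξ *ᵥ v = ((herm ξ).eigenvalues i : ℂ) • v := by
    intro ξ i
    refine ⟨_, ?_, (herm ξ).mulVec_eigenvectorBasis i⟩
    intro h0
    exact (herm ξ).eigenvectorBasis.orthonormal.ne_zero i (by ext j; exact congrFun h0 j)
  have hinj : ∀ ξ, Function.Injective (herm ξ).eigenvalues := by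
    intro ξ a b hab
    by_contra hne
    have ha := (herm ξ).mulVec_eigenvectorBasis a
    have hb := (herm ξ).mulVec_eigenvectorBasis b
    rw [← hab] at hb
    have ha0 : ((herm ξ).eigenvectorBasis a : Fin n → ℂ) ≠ 0 := by
      intro h0
      exact (herm ξ).eigenvectorBasis.orthonormal.ne_zero a (by ext j; exact congrFun h0 j)
    obtain ⟨c, hc⟩ := simple ξ _ _ _ ha hb ha0
    have h1 : (herm ξ).eigenvectorBasis b = c • (herm ξ).eigenvectorBasis a := by
      ext j; exact congrFun hc j
    have h2 : inner ℂ ((herm ξ).eigenvectorBasis a) ((herm ξ).eigenvectorBasis b) = 0 :=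
      (herm ξ).eigenvectorBasis.orthonormal.2 hne
    have h3 := (herm ξ).eigenvectorBasis.orthonormal.1 b
    rw [h1, inner_smul_right, inner_self_eq_norm_sq_to_K,
      (herm ξ).eigenvectorBasis.orthonormal.1 a] at h2
    have h4 : c = 0 := by simpa using h2
    rw [h1, h4, zero_smul, norm_zero] at h3
    exact zero_ne_one h3
  -- `eigenvalues₀` is sorted in decreasing order, whereas `eigenvalues` is a reindexing of it;
  -- `hperm` translates between them.
  let lam : ℝ → Fin n → ℝ := fun ξ i => (herm ξ).eigenvalues₀ (Fin.cast hcard.symm i)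
  have hperm : ∀ ξ, ∃ τ : Fin n ≃ Fin n, ∀ i, (herm ξ).eigenvalues (τ i) = lam ξ i := by
    intro ξ
    refine ⟨(finCongr hcard.symm).trans (Fintype.equivOfCardEq (Fintype.card_fin _)), fun i => ?_⟩
    simp only [Matrix.IsHermitian.eigenvalues, lam, Equiv.trans_apply, Equiv.symm_apply_apply]
    rfl
  have hlam : ∀ ξ, StrictAnti (lam ξ) := by
    intro ξ
    obtain ⟨τ, hτ⟩ := hperm ξ
    refine Antitone.strictAnti_of_injective ?_ ?_
    · exact fun a b hab => (herm ξ).eigenvalues₀_antitone hab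
    · intro a b hab
      rw [← hτ, ← hτ] at hab
      exact τ.injective (hinj ξ hab)
  refine ⟨fun i ξ => lam ξ i, ?_, fun ξ => (hlam ξ).injective, ?_⟩
  · intro i ξ
    -- The characteristic polynomial is real at real arguments; the real part makes it a real
    -- function, so that the implicit function theorem applies over `ℝ`.
    refine analyticAt_sorted_roots
      (fun u => (((Matrix.scalar (Fin n) (u.2 : ℂ)) - H u.1).det).re) ?_ lam hlam ?_ i ξ
    · intro u
      refine (Complex.reCLM.analyticAt _).fun_comp (analyticAt_det fun a b => ?_)
      have h1 : AnalyticAt ℝ (fun y : ℝ × ℝ => H y.1 a b) u := (hH u.1 a b).fun_comp analyticAt_fst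
      have h2 : AnalyticAt ℝ (fun y : ℝ × ℝ => (y.2 : ℂ)) u :=
        (Complex.ofRealCLM.analyticAt _).fun_comp analyticAt_snd
      by_cases hab : a = b
      · subst hab
        simpa using h2.fun_sub h1
      · simpa [hab] using h1.fun_neg
    · intro ξ t
      have h1 := congrArg (Polynomial.eval (t : ℂ)) (herm ξ).charpoly_eq
      rw [Matrix.eval_charpoly, Polynomial.eval_prod] at h1
      obtain ⟨τ, hτ⟩ := hperm ξ
      simp only [h1, Polynomial.eval_sub, Polynomial.eval_X, Polynomial.eval_C]
      rw [← Equiv.prod_comp τ]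
      simp only [hτ]
      have : ∏ i, ((t : ℂ) - ((lam ξ i : ℝ) : ℂ)) = ((∏ i, (t - lam ξ i) : ℝ) : ℂ) := by
        push_cast; rfl
      exact (congrArg Complex.re this).trans (Complex.ofReal_re _)
  · intro i ξ
    obtain ⟨τ, hτ⟩ := hperm ξ
    simp only [← hτ]
    exact hev ξ (τ i)

/-- An analytic function which near `ξ₀` takes values among the values of finitely many analytic
branches, pairwise distinct at `ξ₀`, agrees with a single branch. -/
theorem eqOn_branch {n : ℕ} {U : Set ℝ} (hU : IsPreconnected U) {σ : Fin n → ℝ → ℝ} {f : ℝ → ℝ}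
    (hσ : ∀ i, AnalyticOnNhd ℝ (σ i) U) (hf : AnalyticOnNhd ℝ f U) {ξ₀ : ℝ} (h0 : ξ₀ ∈ U)
    (hinj : Function.Injective fun i => σ i ξ₀) {i : Fin n} (hi : f ξ₀ = σ i ξ₀)
    (hmem : ∀ᶠ ξ in 𝓝 ξ₀, ∃ j, f ξ = σ j ξ) : Set.EqOn f (σ i) U := by
  refine hf.eqOn_of_preconnected_of_eventuallyEq (hσ i) hU h0 ?_
  -- By continuity `f` stays away from every other branch near `ξ₀`, so only `σ i` is left.
  have hne : ∀ᶠ ξ in 𝓝 ξ₀, ∀ j, j ≠ i → f ξ ≠ σ j ξ := by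
    rw [Filter.eventually_all]; intro j
    by_cases hj : j = i
    · exact Filter.Eventually.of_forall fun ξ h => absurd hj h
    · have : f ξ₀ ≠ σ j ξ₀ := by
        rw [hi]; intro e; exact hj (hinj e).symm
      filter_upwards [((hf ξ₀ h0).continuousAt.sub (hσ j ξ₀ h0).continuousAt).eventually_ne
        (sub_ne_zero.2 this)] with ξ hξ _ using sub_ne_zero.1 hξ
  filter_upwards [hne, hmem] with ξ h1 ⟨j, hj⟩
  by_cases hji : j = i
  · rw [hj, hji]
  · exact absurd hj (h1 j hji)

/-! ### The generalized eigenvalue problem and global analytic eigenvectors. -/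

namespace SummationByParts

variable {n : ℕ} {S : SummationByParts (Fin n)}

theorem dot_M_pos {w : Fin n → ℂ} (hw : w ≠ 0) : 0 < (star w ⬝ᵥ (S.M *ᵥ w)).re ∧
    (((star w ⬝ᵥ (S.M *ᵥ w)).re : ℝ) : ℂ) = star w ⬝ᵥ (S.M *ᵥ w) := by
  obtain ⟨h1, h2⟩ := Complex.lt_def.1 (S.posDef.dotProduct_mulVec_pos hw)
  exact ⟨h1, Complex.ext rfl h2⟩

/-- Normalisation with respect to the mass matrix. -/
def normalize (S : SummationByParts (Fin n)) (w : Fin n → ℂ) : Fin n → ℂ :=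
  (((Real.sqrt (star w ⬝ᵥ (S.M *ᵥ w)).re)⁻¹ : ℝ) : ℂ) • w

theorem dot_normalize {w : Fin n → ℂ} (hw : w ≠ 0) :
    star (S.normalize w) ⬝ᵥ (S.M *ᵥ S.normalize w) = 1 := by
  obtain ⟨h1, h2⟩ := S.dot_M_pos hw
  rw [normalize, star_smul, Matrix.mulVec_smul, smul_dotProduct, dotProduct_smul, ← h2]
  simp only [smul_eq_mul, Complex.star_def, Complex.conj_ofReal, Complex.ofReal_re]
  rw [← Complex.ofReal_mul, ← Complex.ofReal_mul, ← mul_assoc, ← mul_inv,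
    Real.mul_self_sqrt h1.le, inv_mul_cancel₀ h1.ne', Complex.ofReal_one]

theorem eigen_normalize {A : Matrix (Fin n) (Fin n) ℂ} {s : ℂ} {w : Fin n → ℂ}
    (h : A *ᵥ w = s • (S.M *ᵥ w)) :
    A *ᵥ S.normalize w = s • (S.M *ᵥ S.normalize w) := by
  rw [normalize, Matrix.mulVec_smul, Matrix.mulVec_smul, h, smul_comm]

theorem dot_eq_zero_of_ne {A : Matrix (Fin n) (Fin n) ℂ} (hA : A.IsHermitian) {s t : ℝ}
    (hst : s ≠ t) {v w : Fin n → ℂ} (hv : A *ᵥ v = (s : ℂ) • (S.M *ᵥ v))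
    (hw : A *ᵥ w = (t : ℂ) • (S.M *ᵥ w)) : star v ⬝ᵥ (S.M *ᵥ w) = 0 := by
  have h1 : star v ⬝ᵥ (A *ᵥ w) = star (star w ⬝ᵥ (A *ᵥ v)) := by
    rw [star_dot_mulVec, hA.eq]
  rw [hv, hw, dotProduct_smul, dotProduct_smul, star_smul, ← S.star_dot_M v w] at h1
  simp only [smul_eq_mul, Complex.star_def, Complex.conj_ofReal] at h1
  have h2 : ((t : ℂ) - s) * (star v ⬝ᵥ (S.M *ᵥ w)) = 0 := by rw [sub_mul, h1, sub_self]
  refine (mul_eq_zero.1 h2).resolve_left (sub_ne_zero.2 ?_)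
  exact_mod_cast hst.symm

theorem linearIndependent_of_orthonormal {v : Fin n → Fin n → ℂ}
    (hv : ∀ i j, star (v i) ⬝ᵥ (S.M *ᵥ v j) = if i = j then 1 else 0) :
    LinearIndependent ℂ v := by
  rw [Fintype.linearIndependent_iff]
  intro g hg i
  have h1 := congrArg (fun w => star (v i) ⬝ᵥ (S.M *ᵥ w)) hg
  simpa [Matrix.mulVec_sum, Matrix.mulVec_smul, dotProduct_sum, dotProduct_smul, hv] using h1

theorem span_of_orthonormal {v : Fin n → Fin n → ℂ}
    (hv : ∀ i j, star (v i) ⬝ᵥ (S.M *ᵥ v j) = if i = j then 1 else 0) :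
    Submodule.span ℂ (Set.range v) = ⊤ :=
  (linearIndependent_of_orthonormal hv).span_eq_top_of_card_eq_finrank' (by simp)

theorem eq_zero_of_orthogonal {v : Fin n → Fin n → ℂ}
    (hv : ∀ i j, star (v i) ⬝ᵥ (S.M *ᵥ v j) = if i = j then 1 else 0) {w : Fin n → ℂ}
    (hw : ∀ i, star (v i) ⬝ᵥ (S.M *ᵥ w) = 0) : w = 0 := by
  have hmem : w ∈ Submodule.span ℂ (Set.range v) := by rw [span_of_orthonormal hv]; trivial
  obtain ⟨c, rfl⟩ := (Submodule.mem_span_range_iff_exists_fun ℂ).1 hmem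
  refine Finset.sum_eq_zero fun i _ => ?_
  have h1 := hw i
  simp only [Matrix.mulVec_sum, Matrix.mulVec_smul, dotProduct_sum, dotProduct_smul, hv] at h1
  have h2 : c i = 0 := by simpa using h1
  rw [h2, zero_smul]

/-- An eigenvector for a value outside the list would be `M`-orthogonal to a whole basis. -/
theorem eigenvalue_mem {A : Matrix (Fin n) (Fin n) ℂ} (hA : A.IsHermitian) {σ : Fin n → ℝ}
    {v : Fin n → Fin n → ℂ}
    (hv : ∀ i j, star (v i) ⬝ᵥ (S.M *ᵥ v j) = if i = j then 1 else 0)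
    (heig : ∀ i, A *ᵥ v i = (σ i : ℂ) • (S.M *ᵥ v i)) {t : ℝ} {w : Fin n → ℂ} (hw0 : w ≠ 0)
    (hw : A *ᵥ w = (t : ℂ) • (S.M *ᵥ w)) : ∃ j, t = σ j := by
  by_contra! hne
  exact hw0 (eq_zero_of_orthogonal hv fun i => dot_eq_zero_of_ne hA (hne i).symm (heig i) hw)

theorem exists_sqrt (S : SummationByParts (Fin n)) :
    ∃ L : Matrix (Fin n) (Fin n) ℂ, IsUnit L ∧ S.M = Lᴴ * L := by
  open scoped MatrixOrder Matrix.Norms.L2Operator in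
  exact CStarAlgebra.isStrictlyPositive_iff_eq_star_mul_self.1 S.posDef.isStrictlyPositive

theorem analyticAt_K {z : ℝ → ℂ} {ξ : ℝ} (hz : AnalyticAt ℝ z ξ) (i j : Fin n) :
    AnalyticAt ℝ (fun ξ => S.K (z ξ) i j) ξ := by
  have hzs : AnalyticAt ℝ (fun ξ => star (z ξ)) ξ :=
    (Complex.conjCLE.toContinuousLinearMap.analyticAt _).fun_comp hz
  simp only [K, Matrix.mul_apply]
  refine Finset.analyticAt_fun_sum _ fun a _ => ?_
  refine AnalyticAt.fun_mul (Finset.analyticAt_fun_sum _ fun b _ => ?_) ?_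
  · refine AnalyticAt.fun_mul ?_ analyticAt_const
    simp only [conjTranspose_D, Matrix.sub_apply, Matrix.smul_apply, smul_eq_mul]
    exact analyticAt_const.fun_sub (hzs.fun_mul analyticAt_const)
  · simp only [D, Matrix.sub_apply, Matrix.smul_apply, smul_eq_mul]
    exact analyticAt_const.fun_sub (hz.fun_mul analyticAt_const)

/-- With `M = Lᴴ L`, the substitution `v = L⁻¹ w` gives a standard Hermitian problem with constant
`L`, preserving analyticity and simplicity. -/
theorem exists_analytic_eigenvalues (S : SummationByParts (Fin n)) {z : ℝ → ℂ}
    (hz : ∀ ξ, AnalyticAt ℝ z ξ) (hz1 : ∀ ξ, ‖z ξ‖ = 1) :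
    ∃ σ : Fin n → ℝ → ℝ, (∀ i ξ, AnalyticAt ℝ (σ i) ξ) ∧
      (∀ ξ, Function.Injective fun i => σ i ξ) ∧
      ∀ i ξ, ∃ v : Fin n → ℂ, v ≠ 0 ∧ S.K (z ξ) *ᵥ v = (σ i ξ : ℂ) • (S.M *ᵥ v) := by
  obtain ⟨L, hL, hM⟩ := S.exists_sqrt
  have hdet := (Matrix.isUnit_iff_isUnit_det _).1 hL
  have hL1 : L⁻¹ * L = 1 := Matrix.nonsing_inv_mul _ hdet
  have hL2 : L * L⁻¹ = 1 := Matrix.mul_nonsing_inv _ hdet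
  have hL3 : Lᴴ * L⁻¹ᴴ = 1 := by
    rw [← Matrix.conjTranspose_mul, hL1, Matrix.conjTranspose_one]
  have key : ∀ ξ (t : ℝ) (v : Fin n → ℂ),
      (L⁻¹ᴴ * S.K (z ξ) * L⁻¹) *ᵥ v = (t : ℂ) • v →
        S.K (z ξ) *ᵥ (L⁻¹ *ᵥ v) = (t : ℂ) • (S.M *ᵥ (L⁻¹ *ᵥ v)) := by
    intro ξ t v hv
    have h1 := congrArg (fun w => Lᴴ *ᵥ w) hv
    simp only [Matrix.mulVec_mulVec, Matrix.mulVec_smul] at h1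
    rw [Matrix.mul_assoc, ← Matrix.mul_assoc, hL3, Matrix.one_mul] at h1
    rw [Matrix.mulVec_mulVec, Matrix.mulVec_mulVec, h1, hM, Matrix.mul_assoc, hL2,
      Matrix.mul_one]
  have hback : ∀ v : Fin n → ℂ, L *ᵥ (L⁻¹ *ᵥ v) = v := fun v => by
    rw [Matrix.mulVec_mulVec, hL2, Matrix.one_mulVec]
  have hex := LDG.exists_analytic_eigenvalues (fun ξ => L⁻¹ᴴ * S.K (z ξ) * L⁻¹)
    (fun ξ i j => by
      simp only [Matrix.mul_apply]
      refine Finset.analyticAt_fun_sum _ fun a _ => AnalyticAt.fun_mul ?_ analyticAt_const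
      exact Finset.analyticAt_fun_sum _ fun b _ =>
        analyticAt_const.fun_mul (analyticAt_K (hz ξ) b a))
    (fun ξ => Matrix.isHermitian_conjTranspose_mul_mul _ (S.isHermitian_K _))
    (fun ξ t v w hv hw hv0 => by
      obtain ⟨c, hc⟩ := simple (hz1 ξ) (key ξ t v hv) (key ξ t w hw) (fun h0 => hv0 (by
        rw [← hback v, h0, Matrix.mulVec_zero]))
      exact ⟨c, by rw [← hback w, hc, Matrix.mulVec_smul, hback]⟩)
  obtain ⟨σ, h1, h2, h3⟩ := hex
  refine ⟨σ, h1, h2, fun i ξ => ?_⟩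
  obtain ⟨v, hv0, hv⟩ := h3 i ξ
  refine ⟨L⁻¹ *ᵥ v, fun h0 => hv0 ?_, key ξ _ v hv⟩
  rw [← hback v, h0, Matrix.mulVec_zero]

theorem analyticAt_dotProduct {f g : ℝ → Fin n → ℂ} {ξ : ℝ} (hf : AnalyticAt ℝ f ξ)
    (hg : AnalyticAt ℝ g ξ) : AnalyticAt ℝ (fun x => f x ⬝ᵥ g x) ξ := by
  simp only [dotProduct]
  exact Finset.analyticAt_fun_sum _ fun i _ =>
    (analyticAt_pi_iff.1 hf i).fun_mul (analyticAt_pi_iff.1 hg i)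

theorem analyticAt_mulVec {A : ℝ → Matrix (Fin n) (Fin n) ℂ} {g : ℝ → Fin n → ℂ} {ξ : ℝ}
    (hA : ∀ i j, AnalyticAt ℝ (fun x => A x i j) ξ)
    (hg : AnalyticAt ℝ g ξ) : AnalyticAt ℝ (fun x => A x *ᵥ g x) ξ :=
  analyticAt_pi_iff.2 fun i => analyticAt_dotProduct (analyticAt_pi_iff.2 fun j => hA i j) hg

theorem analyticAt_star {f : ℝ → Fin n → ℂ} {ξ : ℝ} (hf : AnalyticAt ℝ f ξ) :
    AnalyticAt ℝ (fun x => star (f x)) ξ :=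
  analyticAt_pi_iff.2 fun i =>
    (Complex.conjCLE.toContinuousLinearMap.analyticAt _).fun_comp (analyticAt_pi_iff.1 hf i)

theorem analyticAt_normalize {w : ℝ → Fin n → ℂ} {ξ : ℝ} (hw : AnalyticAt ℝ w ξ)
    (hw0 : w ξ ≠ 0) : AnalyticAt ℝ (fun x => S.normalize (w x)) ξ := by
  have h1 : AnalyticAt ℝ (fun x => (star (w x) ⬝ᵥ (S.M *ᵥ w x)).re) ξ :=
    (Complex.reCLM.analyticAt _).fun_comp (analyticAt_dotProduct (analyticAt_star hw)
      (analyticAt_mulVec (fun _ _ => analyticAt_const) hw))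
  have hpos := (S.dot_M_pos hw0).1
  have h2 : AnalyticAt ℝ (fun x => Real.sqrt (star (w x) ⬝ᵥ (S.M *ᵥ w x)).re) ξ :=
    AnalyticAt.fun_comp (g := Real.sqrt) (Real.contDiffAt_sqrt (n := ω) hpos.ne').analyticAt h1
  have h3 := h2.fun_inv (Real.sqrt_pos.2 hpos).ne'
  have h4 : AnalyticAt ℝ (fun x => (((Real.sqrt (star (w x) ⬝ᵥ (S.M *ᵥ w x)).re)⁻¹ : ℝ) : ℂ)) ξ :=
    (Complex.ofRealCLM.analyticAt _).fun_comp h3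
  exact analyticAt_pi_iff.2 fun i => h4.fun_mul (analyticAt_pi_iff.1 hw i)

theorem analyticAt_adjugate {A : ℝ → Matrix (Fin n) (Fin n) ℂ} {ξ : ℝ}
    (hA : ∀ i j, AnalyticAt ℝ (fun x => A x i j) ξ) (i j : Fin n) :
    AnalyticAt ℝ (fun x => (A x).adjugate i j) ξ := by
  simp only [Matrix.adjugate_apply]
  refine analyticAt_det fun a b => ?_
  simp only [Matrix.updateRow_apply]
  split_ifs
  · exact analyticAt_const
  · exact hA a b

theorem exists_analytic_eigenvector {z : ℝ → ℂ} (hz : ∀ ξ, AnalyticAt ℝ z ξ)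
    (hz1 : ∀ ξ, ‖z ξ‖ = 1) {σ : Fin n → ℝ → ℝ} (hσ : ∀ i ξ, AnalyticAt ℝ (σ i) ξ)
    (hinj : ∀ ξ, Function.Injective fun i => σ i ξ)
    (hev : ∀ i ξ, ∃ v : Fin n → ℂ, v ≠ 0 ∧ S.K (z ξ) *ᵥ v = (σ i ξ : ℂ) • (S.M *ᵥ v))
    (i : Fin n) : ∃ w : ℝ → Fin n → ℂ, (∀ ξ, AnalyticAt ℝ w ξ) ∧
      ∀ ξ, w ξ ≠ 0 ∧ S.K (z ξ) *ᵥ w ξ = (σ i ξ : ℂ) • (S.M *ᵥ w ξ) := by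
  by_cases hflat : ∃ ξ v, v ≠ 0 ∧ S.K (z ξ) *ᵥ v = (σ i ξ : ℂ) • (S.M *ᵥ v) ∧ S.r ⬝ᵥ v = 0
  · obtain ⟨ξ₀, v, hv0, hv, hr⟩ := hflat
    have hall := fun ξ => eigen_of_r_eq_zero (hz1 ξ₀) hv hv0 hr (z ξ)
    -- The value `σ i ξ₀` is an eigenvalue for every `ξ`, so the branch through it is constant.
    have hconst : Set.EqOn (fun _ => σ i ξ₀) (σ i) Set.univ := by
      refine eqOn_branch isPreconnected_univ (fun j ξ _ => hσ j ξ) (fun ξ _ => analyticAt_const)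
        (Set.mem_univ ξ₀) (hinj ξ₀) rfl (Filter.Eventually.of_forall fun ξ => ?_)
      choose u hu0 hu using fun j => hev j ξ
      refine eigenvalue_mem (S.isHermitian_K (z ξ)) (v := fun j => S.normalize (u j)) ?_
        (fun j => eigen_normalize (hu j)) hv0 (hall ξ)
      intro a b
      split_ifs with hab
      · subst hab; exact dot_normalize (hu0 a)
      · exact dot_eq_zero_of_ne (S.isHermitian_K (z ξ)) (fun e => hab (hinj ξ e))
          (eigen_normalize (hu a)) (eigen_normalize (hu b))
    refine ⟨fun _ => v, fun ξ => analyticAt_const, fun ξ => ⟨hv0, ?_⟩⟩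
    rw [← hconst (Set.mem_univ ξ)]
    exact hall ξ
  · push Not at hflat
    let T : ℝ → Matrix (Fin n) (Fin n) ℂ := fun ξ =>
      S.K (z ξ) - (σ i ξ : ℂ) • S.M + Matrix.vecMulVec S.r S.r
    have hTv : ∀ ξ v, T ξ *ᵥ v =
        S.K (z ξ) *ᵥ v - (σ i ξ : ℂ) • (S.M *ᵥ v) + (S.r ⬝ᵥ v) • S.r := by
      intro ξ v
      simp only [T, Matrix.add_mulVec, Matrix.sub_mulVec, Matrix.smul_mulVec, vecMulVec_mulVec']
    -- Pairing `T x = 0` with the eigenvector `v` cancels the Hermitian part and leaves `star (r·v)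
    -- * (r·x) = 0`. Then `r·x = 0`, so `x` is an eigenvector with zero right trace, which is
    -- excluded here.
    have hdet : ∀ ξ, (T ξ).det ≠ 0 := by
      intro ξ h0
      obtain ⟨x, hx0, hx⟩ := Matrix.exists_mulVec_eq_zero_iff.2 h0
      obtain ⟨v, hv0, hv⟩ := hev i ξ
      rw [hTv] at hx
      have h1 := congrArg (fun w => star v ⬝ᵥ w) hx
      simp only [dotProduct_add, dotProduct_sub, dotProduct_smul, dotProduct_zero] at h1
      rw [star_dot_mulVec, (S.isHermitian_K _).eq, hv, dotProduct_smul, star_smul,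
        ← S.star_dot_M v x, Complex.star_def, Complex.conj_ofReal, sub_self, zero_add,
        star_dot_r, smul_eq_mul, mul_eq_zero, star_eq_zero] at h1
      have h2 := h1.resolve_right (hflat ξ v hv0 hv)
      rw [h2, zero_smul, add_zero, sub_eq_zero] at hx
      exact hflat ξ x hx0 hx h2
    have hT : ∀ ξ a b, AnalyticAt ℝ (fun ξ => T ξ a b) ξ := by
      intro ξ a b
      simp only [T, Matrix.add_apply, Matrix.sub_apply, Matrix.smul_apply, smul_eq_mul]
      have h1 : AnalyticAt ℝ (fun x => (σ i x : ℂ)) ξ :=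
        (Complex.ofRealCLM.analyticAt _).fun_comp (hσ i ξ)
      exact ((analyticAt_K (hz ξ) a b).fun_sub (h1.fun_mul analyticAt_const)).fun_add
        analyticAt_const
    refine ⟨fun ξ => (T ξ).adjugate *ᵥ S.r, fun ξ =>
      analyticAt_mulVec (analyticAt_adjugate (hT ξ)) analyticAt_const, fun ξ => ?_⟩
    obtain ⟨v, hv0, hv⟩ := hev i ξ
    have hr := hflat ξ v hv0 hv
    -- This is the adjugate applied to `T v = (r·v) r`.
    have h1 : (T ξ).det • v = (S.r ⬝ᵥ v) • ((T ξ).adjugate *ᵥ S.r) := by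
      rw [← Matrix.mulVec_smul, ← zero_add ((S.r ⬝ᵥ v) • S.r),
        ← sub_self ((σ i ξ : ℂ) • (S.M *ᵥ v))]
      conv_rhs => rw [← hv]
      nth_rewrite 2 [hv]
      rw [← hTv, Matrix.mulVec_mulVec, Matrix.adjugate_mul, Matrix.smul_mulVec, Matrix.one_mulVec]
    have h2 : (T ξ).adjugate *ᵥ S.r = ((S.r ⬝ᵥ v)⁻¹ * (T ξ).det) • v := by
      rw [mul_smul, h1, smul_smul, inv_mul_cancel₀ hr, one_smul]
    beta_reduce
    rw [h2]
    refine ⟨smul_ne_zero (mul_ne_zero (inv_ne_zero hr) (hdet ξ)) hv0, ?_⟩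
    rw [Matrix.mulVec_smul, Matrix.mulVec_smul, hv, smul_comm]

end SummationByParts

theorem analyticAt_bloch (h ξ : ℝ) : AnalyticAt ℝ (bloch h) ξ := by
  have h1 : AnalyticAt ℝ (fun ξ : ℝ => (ξ : ℂ)) ξ := Complex.ofRealCLM.analyticAt _
  have h2 : AnalyticAt ℝ Complex.exp (-(Complex.I * (ξ : ℂ) * (h : ℂ))) :=
    (analyticAt_cexp (z := -(Complex.I * (ξ : ℂ) * (h : ℂ)))).restrictScalars
  exact AnalyticAt.fun_comp (g := Complex.exp) (f := fun ξ : ℝ => -(Complex.I * (ξ : ℂ) * (h : ℂ)))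
    h2 ((analyticAt_const.fun_mul h1).fun_mul analyticAt_const).fun_neg

theorem exists_isAnalyticEigensystem (k : ℕ) {h : ℝ} (hh : 0 < h) :
    ∃ (σ : Fin (k + 1) → ℝ → ℝ) (v : Fin (k + 1) → ℝ → Fin (k + 1) → ℂ),
      IsAnalyticEigensystem k h Set.univ σ v := by
  set S := sbp k h hh with hS
  obtain ⟨σ, h1, h2, h3⟩ := S.exists_analytic_eigenvalues (analyticAt_bloch h) (norm_bloch h)
  choose w hw hw' using S.exists_analytic_eigenvector (analyticAt_bloch h) (norm_bloch h) h1 h2 h3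
  have horth : ∀ i j ξ, star (S.normalize (w i ξ)) ⬝ᵥ (S.M *ᵥ S.normalize (w j ξ)) =
      if i = j then 1 else 0 := by
    intro i j ξ
    split_ifs with hij
    · subst hij; exact SummationByParts.dot_normalize (hw' i ξ).1
    · exact SummationByParts.dot_eq_zero_of_ne (S.isHermitian_K _) (fun e => hij (h2 ξ e))
        (SummationByParts.eigen_normalize (hw' i ξ).2)
        (SummationByParts.eigen_normalize (hw' j ξ).2)
  refine ⟨σ, fun i ξ => S.normalize (w i ξ), fun i ξ _ => h1 i ξ,
    fun i ξ _ => SummationByParts.analyticAt_normalize (hw i ξ) (hw' i ξ).1, fun i ξ _ => ?_,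
    fun i j ξ _ => horth i j ξ, fun ξ _ => ⟨?_, ?_⟩⟩
  · rw [symbol_eq k h hh, Matrix.sub_mulVec, Matrix.smul_mulVec, sub_eq_zero]
    exact SummationByParts.eigen_normalize (hw' i ξ).2
  · exact SummationByParts.linearIndependent_of_orthonormal (S := S) fun i j => horth i j ξ
  · exact SummationByParts.span_of_orthonormal (S := S) fun i j => horth i j ξ

/-! ### Second-order expansion at the zero eigenvalue. -/

theorem hasDerivAt_mulVec {n : ℕ} (A : Matrix (Fin n) (Fin n) ℂ) {f : ℝ → Fin n → ℂ}
    {f' : Fin n → ℂ} {x : ℝ} (hf : HasDerivAt f f' x) :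
    HasDerivAt (fun y => A *ᵥ f y) (A *ᵥ f') x := by
  rw [hasDerivAt_pi] at hf ⊢
  intro i
  simp only [Matrix.mulVec, dotProduct]
  exact HasDerivAt.fun_sum fun j _ => (hf j).const_mul _

theorem hasDerivAt_dotProduct {n : ℕ} (a : Fin n → ℂ) {f : ℝ → Fin n → ℂ}
    {f' : Fin n → ℂ} {x : ℝ} (hf : HasDerivAt f f' x) :
    HasDerivAt (fun y => a ⬝ᵥ f y) (a ⬝ᵥ f') x := by
  rw [hasDerivAt_pi] at hf
  simp only [dotProduct]
  exact HasDerivAt.fun_sum fun j _ => (hf j).const_mul _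

/-- Leibniz' rule of order two. -/
theorem iteratedDeriv_two_mul {f g : ℝ → ℂ} {x : ℝ} (hf : AnalyticAt ℝ f x)
    (hg : AnalyticAt ℝ g x) :
    iteratedDeriv 2 (fun y => f y * g y) x =
      iteratedDeriv 2 f x * g x + 2 * (deriv f x * deriv g x) + f x * iteratedDeriv 2 g x := by
  have h := iteratedDeriv_fun_mul (n := 2) (hf.contDiffAt (n := 2)) (hg.contDiffAt (n := 2))
  rw [h]
  simp [Finset.sum_range_succ, iteratedDeriv_one]
  ring

theorem iteratedDeriv_two_ofReal {f : ℝ → ℝ} {x : ℝ} (hf : AnalyticAt ℝ f x) :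
    iteratedDeriv 2 (fun y => (f y : ℂ)) x = (iteratedDeriv 2 f x : ℝ) := by
  rw [iteratedDeriv_succ, iteratedDeriv_one, iteratedDeriv_succ, iteratedDeriv_one]
  have h1 : deriv (fun y => (f y : ℂ)) =ᶠ[𝓝 x] fun y => ((deriv f y : ℝ) : ℂ) := by
    filter_upwards [hf.eventually_analyticAt] with y hy
    exact hy.differentiableAt.hasDerivAt.ofReal_comp.deriv
  rw [h1.deriv_eq]
  exact hf.deriv.differentiableAt.hasDerivAt.ofReal_comp.deriv

namespace SummationByParts

variable {n : ℕ} {S : SummationByParts (Fin n)}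

theorem star_M_inv_mulVec (w : Fin n → ℂ) : star (S.M⁻¹ *ᵥ w) = S.M⁻¹ *ᵥ star w := by
  apply S.M_injective
  have h1 : star (S.M *ᵥ (S.M⁻¹ *ᵥ w)) = S.M *ᵥ star (S.M⁻¹ *ᵥ w) := by
    rw [star_mulVec_map, S.star_M]
  rw [← h1, M_mulVec_inv, M_mulVec_inv]

theorem star_conjTranspose_D_mulVec (z : ℂ) (q : Fin n → ℂ) :
    star ((S.D z)ᴴ *ᵥ q) = (S.D (star z))ᴴ *ᵥ star q := by
  rw [star_mulVec_map]
  congr 1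
  ext i j
  simp only [conjTranspose_D, Matrix.map_apply, Matrix.sub_apply, Matrix.add_apply,
    Matrix.neg_apply, Matrix.smul_apply, Matrix.vecMulVec_apply, Matrix.mul_apply, star_sub,
    star_add, star_neg, star_sum, star_mul', smul_eq_mul]
  have hM : ∀ a b, star (S.M a b) = S.M a b := fun a b => congrFun (congrFun S.star_M a) b
  have hN : ∀ a b, star (S.N a b) = S.N a b := fun a b => congrFun (congrFun S.star_N a) b
  have hr : ∀ a, star (S.r a) = S.r a := fun a => congrFun S.star_r a
  have hl : ∀ a, star (S.l a) = S.l a := fun a => congrFun S.star_l a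
  simp only [hM, hN, hr, hl]

theorem star_K_mulVec (z : ℂ) (v : Fin n → ℂ) :
    star (S.K z *ᵥ v) = S.K (star z) *ᵥ star v := by
  rw [K_mulVec, K_mulVec, star_conjTranspose_D_mulVec, star_M_inv_mulVec, D_star]

theorem e_ne_zero : S.e ≠ 0 := by
  intro h0
  have := S.r_e
  rw [h0, dotProduct_zero] at this
  exact zero_ne_one this

theorem D_e (z : ℂ) : S.D z *ᵥ S.e = (1 - z) • S.l := by
  rw [D_mulVec, S.N_e, Matrix.mulVec_zero, zero_add, jump, S.l_e, S.r_e, mul_one]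

theorem conjTranspose_D_e (z : ℂ) : (S.D z)ᴴ *ᵥ S.e = (1 - star z) • S.r := by
  rw [conjTranspose_D_mulVec, S.N_e, Matrix.mulVec_zero, neg_zero, zero_add, S.l_e, S.r_e,
    mul_one]

theorem K_one_e : S.K 1 *ᵥ S.e = 0 := by
  rw [K_mulVec, D_e, sub_self, zero_smul, Matrix.mulVec_zero, Matrix.mulVec_zero]

theorem F_e : S.F *ᵥ S.e = S.e := by
  obtain ⟨c, hc⟩ := S.ker (S.F *ᵥ S.e) (by rw [N_F, S.N_e, Matrix.mulVec_zero, neg_zero])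
  have h1 : S.r ⬝ᵥ (S.F *ᵥ S.e) = 1 := by rw [dot_F, S.F_r, S.l_e]
  rw [hc, dotProduct_smul, S.r_e, smul_eq_mul, mul_one] at h1
  rw [hc, h1, one_smul]

/-- Reflection with conjugation carries this kernel into that of `D z`, and it fixes `e`. -/
theorem ker_conjTranspose_D {z : ℂ} (hz : ‖z‖ = 1) {q : Fin n → ℂ} (h : (S.D z)ᴴ *ᵥ q = 0) :
    ∃ c : ℂ, q = c • S.e := by
  have h1 := S.D_F_star z q
  rw [h, star_zero, Matrix.mulVec_zero] at h1
  obtain ⟨-, c, hc⟩ := ker_D hz h1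
  have h2 := congrArg (fun w => star (S.F *ᵥ w)) hc
  simp only [Matrix.mulVec_mulVec, S.F_F, Matrix.one_mulVec, star_star, Matrix.mulVec_smul, F_e,
    star_smul, S.star_e] at h2
  exact ⟨_, h2⟩

theorem eq_smul_e_of_K_one {v : Fin n → ℂ} (h : S.K 1 *ᵥ v = 0) : ∃ c : ℂ, v = c • S.e :=
  (ker_D (by simp) (D_eq_zero_of_K h)).2

theorem eigenvalue_nonneg {z : ℂ} {s : ℝ} {v : Fin n → ℂ}
    (hv : S.K z *ᵥ v = (s : ℂ) • (S.M *ᵥ v)) (h1 : star v ⬝ᵥ (S.M *ᵥ v) = 1) : 0 ≤ s := by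
  have h := (S.posSemidef_K z).dotProduct_mulVec_nonneg v
  rw [hv, dotProduct_smul, h1, smul_eq_mul, mul_one] at h
  exact_mod_cast h

/-- The curvature of an eigenvalue branch which vanishes together with its slope at a point where
the Bloch factor is `1`. -/
theorem iteratedDeriv_two_eigenvalue {z : ℝ → ℂ} (hz : AnalyticAt ℝ z 0)
    (hz0 : z 0 = 1) {σ : ℝ → ℝ} {v : ℝ → Fin n → ℂ} (hσ : AnalyticAt ℝ σ 0)
    (hv : AnalyticAt ℝ v 0) (hσ0 : σ 0 = 0) (hσ1 : deriv σ 0 = 0) {c : ℂ} (hc : c ≠ 0)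
    (hvc : v 0 = c • S.e)
    (heig : ∀ᶠ ξ in 𝓝 0, S.K (z ξ) *ᵥ v ξ = (σ ξ : ℂ) • (S.M *ᵥ v ξ)) :
    ((iteratedDeriv 2 σ 0 : ℝ) : ℂ) * (S.e ⬝ᵥ (S.M *ᵥ S.e)) ^ 2 =
      2 * (star (deriv z 0) * deriv z 0) := by
  set μ := S.e ⬝ᵥ (S.M *ᵥ S.e) with hμ
  let zs : ℝ → ℂ := fun ξ => star (z ξ)
  have hzs : AnalyticAt ℝ zs 0 :=
    (Complex.conjCLE.toContinuousLinearMap.analyticAt _).fun_comp hz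
  have hzs0 : zs 0 = 1 := by simp [zs, hz0]
  have hdz := hz.differentiableAt.hasDerivAt
  have hdzs : HasDerivAt zs (star (deriv z 0)) 0 := hdz.star
  let q : ℝ → Fin n → ℂ := fun ξ => S.M⁻¹ *ᵥ (S.D (z ξ) *ᵥ v ξ)
  have hMq : ∀ ξ, S.M *ᵥ q ξ = S.D (z ξ) *ᵥ v ξ := fun ξ => S.M_mulVec_inv _
  have hq : AnalyticAt ℝ q 0 := by
    refine SummationByParts.analyticAt_mulVec (fun _ _ => analyticAt_const)
      (SummationByParts.analyticAt_mulVec (fun i j => ?_) hv)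
    simp only [D, Matrix.sub_apply, Matrix.smul_apply, smul_eq_mul]
    exact analyticAt_const.fun_sub (hz.fun_mul analyticAt_const)
  have hq0 : q 0 = 0 := by
    simp only [q, hvc, hz0, Matrix.mulVec_smul, D_e, sub_self, zero_smul, smul_zero,
      Matrix.mulVec_zero]
  have hdv := hv.differentiableAt.hasDerivAt
  have hdq := hq.differentiableAt.hasDerivAt
  have hdσ : HasDerivAt (fun ξ => (σ ξ : ℂ)) 0 0 := by
    simpa [hσ1] using hσ.differentiableAt.hasDerivAt.ofReal_comp
  -- the derivative of `q` is constant
  have hker : (S.D 1)ᴴ *ᵥ deriv q 0 = 0 := by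
    -- The eigenvalue equation is `(D z)ᴴ q = σ M v`; replacing `z` by `1` costs a multiple of `r`.
    -- At `0` both terms on the right have zero derivative: `σ` and its slope vanish, and so do `q`
    -- and `zs - 1`.
    have h1 : (fun ξ => (S.D 1)ᴴ *ᵥ q ξ) =ᶠ[𝓝 0]
        fun ξ => (σ ξ : ℂ) • (S.M *ᵥ v ξ) + ((zs ξ - 1) * (S.l ⬝ᵥ q ξ)) • S.r := by
      filter_upwards [heig] with ξ hξ
      rw [← hξ, K_mulVec, conjTranspose_D_mulVec, conjTranspose_D_mulVec]
      simp only [q, zs, star_one]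
      module
    have h2 := (hasDerivAt_mulVec (S.D 1)ᴴ hdq).congr_of_eventuallyEq h1.symm
    have h3 := (hdσ.smul (hasDerivAt_mulVec S.M hdv)).add
      (((hdzs.sub_const 1).mul (hasDerivAt_dotProduct S.l hdq)).smul_const S.r)
    have h4 := h2.unique h3
    simpa [hσ0, hq0, hzs0] using h4
  obtain ⟨a, ha⟩ := ker_conjTranspose_D (S := S) (z := 1) (by simp) hker
  -- Testing `M q = D z v` with `e` gives the scalar identity `e·Mq = (1 - z)(r·v)`; its derivative
  -- at `0` fixes `a`.
  have haμ : a * μ = -deriv z 0 * c := by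
    have h1 : (fun ξ => S.e ⬝ᵥ (S.M *ᵥ q ξ)) = fun ξ => (1 - z ξ) * (S.r ⬝ᵥ v ξ) := by
      ext ξ
      have h2 := star_dot_mulVec (S.D (z ξ)) S.e (v ξ)
      rw [conjTranspose_D_e, dotProduct_smul, star_smul, star_dot_r, star_star, S.star_e] at h2
      rw [hMq, h2]
      simp
    have h2 := hasDerivAt_dotProduct S.e (hasDerivAt_mulVec S.M hdq)
    rw [h1] at h2
    have h3 := h2.unique ((hdz.const_sub 1).mul (hasDerivAt_dotProduct S.r hdv))
    simpa [ha, hvc, hz0, Matrix.mulVec_smul, dotProduct_smul, S.r_e, ← hμ] using h3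
  -- compare second derivatives
  have hid : (fun ξ => (σ ξ : ℂ) * (S.e ⬝ᵥ (S.M *ᵥ v ξ))) =ᶠ[𝓝 0]
      fun ξ => (1 - zs ξ) * (S.l ⬝ᵥ q ξ) := by
    filter_upwards [heig] with ξ hξ
    have h1 := congrArg (fun w => S.e ⬝ᵥ w) hξ
    simp only [dotProduct_smul, smul_eq_mul] at h1
    rw [← h1, K_mulVec]
    have h2 := star_dot_mulVec (S.D (z ξ))ᴴ S.e (q ξ)
    rw [Matrix.conjTranspose_conjTranspose, D_e, dotProduct_smul, star_smul, star_dot_l,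
      star_star, S.star_e] at h2
    simpa [zs, q] using h2
  have h1 := hid.iteratedDeriv_eq 2
  have hσc : AnalyticAt ℝ (fun ξ => (σ ξ : ℂ)) 0 :=
    (Complex.ofRealCLM.analyticAt _).fun_comp hσ
  rw [iteratedDeriv_two_mul hσc (SummationByParts.analyticAt_dotProduct analyticAt_const
      (SummationByParts.analyticAt_mulVec (A := fun _ => S.M) (fun _ _ => analyticAt_const) hv)),
    iteratedDeriv_two_mul (analyticAt_const.fun_sub hzs)
      (SummationByParts.analyticAt_dotProduct analyticAt_const hq),
    iteratedDeriv_two_ofReal hσ, hdσ.deriv, (hdzs.const_sub 1).deriv,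
    (hasDerivAt_dotProduct S.l hdq).deriv, hσ0, hq0, hzs0, hvc, ha] at h1
  simp only [Matrix.mulVec_smul, dotProduct_smul, S.l_e, ← hμ, smul_eq_mul, dotProduct_zero,
    Complex.ofReal_zero] at h1
  refine mul_left_cancel₀ hc ?_
  -- The second derivatives give `σ'' c μ = -2 (star z') a`; multiplying by `μ` and inserting `a μ =
  -- -z' c` eliminates `a`.
  linear_combination μ * h1 - 2 * star (deriv z 0) * haμ

end SummationByParts

theorem massMatrix_zero_zero (k : ℕ) (h : ℝ) : massMatrix k h 0 0 = h := by
  simp [massMatrix, basisFun_zero_apply]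

theorem hasDerivAt_bloch_zero (h : ℝ) : HasDerivAt (bloch h) (-(Complex.I * h)) 0 := by
  have h1 : HasDerivAt (fun ξ : ℝ => -(Complex.I * (ξ : ℂ) * (h : ℂ))) (-(Complex.I * h)) 0 := by
    have := ((((hasDerivAt_id (0 : ℝ)).ofReal_comp).const_mul Complex.I).mul_const (h : ℂ)).fun_neg
    simpa using this
  have h2 := h1.cexp
  simp only [Complex.ofReal_zero, mul_zero, zero_mul, neg_zero, Complex.exp_zero, one_mul] at h2
  exact h2

end

end LDG

/-! ### Assembly of the theorem. -/

theorem theorem3p1 (k : ℕ) (h : ℝ) (hh : 0 < h) :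
    (∃ (σ : Fin (k + 1) → ℝ → ℝ) (v : Fin (k + 1) → ℝ → Fin (k + 1) → ℂ),
      LDG.IsAnalyticEigensystem k h Set.univ σ v) ∧
    ∀ (σ : Fin (k + 1) → ℝ → ℝ) (v : Fin (k + 1) → ℝ → Fin (k + 1) → ℂ),
      LDG.IsAnalyticEigensystem k h (Set.Icc (-(Real.pi / h)) (Real.pi / h)) σ v →
        (∃ p : Fin (k + 1), LDG.IsPhysicalBranch k σ v p ∧
          (∀ i, LDG.IsPhysicalBranch k σ v i → i = p) ∧ ∀ i, i ≠ p → 0 < σ i 0) ∧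
        ∀ i, ∀ ξ ∈ Set.Icc (-(Real.pi / h)) (Real.pi / h), σ i (-ξ) = σ i ξ := by
  refine ⟨LDG.exists_isAnalyticEigensystem k hh, fun σ v sys => ?_⟩
  set S := LDG.sbp k h hh with hS
  set I := Set.Icc (-(Real.pi / h)) (Real.pi / h) with hI
  have hpos : 0 < Real.pi / h := div_pos Real.pi_pos hh
  have hInhds : I ∈ nhds (0 : ℝ) := Icc_mem_nhds (by linarith) hpos
  have h0I : (0 : ℝ) ∈ I := mem_of_mem_nhds hInhds
  have heig : ∀ i, ∀ ξ ∈ I, S.K (LDG.bloch h ξ) *ᵥ v i ξ = (σ i ξ : ℂ) • (S.M *ᵥ v i ξ) := by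
    intro i ξ hξ
    have h1 := sys.eigen i ξ hξ
    rwa [LDG.symbol_eq k h hh, Matrix.sub_mulVec, Matrix.smul_mulVec, sub_eq_zero] at h1
  have horth : ∀ ξ ∈ I, ∀ i j, star (v i ξ) ⬝ᵥ (S.M *ᵥ v j ξ) = if i = j then 1 else 0 :=
    fun ξ hξ i j => sys.orthonormal i j ξ hξ
  have hnorm : ∀ i, ∀ ξ ∈ I, star (v i ξ) ⬝ᵥ (S.M *ᵥ v i ξ) = 1 := fun i ξ hξ => by
    rw [horth ξ hξ, if_pos rfl]
  have hne : ∀ i, ∀ ξ ∈ I, v i ξ ≠ 0 := by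
    intro i ξ hξ h0
    have h1 := hnorm i ξ hξ
    rw [h0, Matrix.mulVec_zero, dotProduct_zero] at h1
    exact zero_ne_one h1
  have hnn : ∀ i, ∀ ξ ∈ I, 0 ≤ σ i ξ := fun i ξ hξ =>
    LDG.SummationByParts.eigenvalue_nonneg (heig i ξ hξ) (hnorm i ξ hξ)
  have hmem : ∀ ξ ∈ I, ∀ (t : ℝ) (w : Fin (k + 1) → ℂ), w ≠ 0 →
      S.K (LDG.bloch h ξ) *ᵥ w = (t : ℂ) • (S.M *ᵥ w) → ∃ j, t = σ j ξ := fun ξ hξ t w hw0 hw =>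
    LDG.SummationByParts.eigenvalue_mem (S.isHermitian_K _) (horth ξ hξ)
      (fun i => heig i ξ hξ) hw0 hw
  -- By simplicity, two branches meeting at `0` would have parallel eigenvectors, contradicting
  -- orthonormality.
  have hinj : Function.Injective fun i => σ i 0 := by
    intro i j hij
    by_contra hne'
    have hj := heig j 0 h0I
    rw [← show σ i 0 = σ j 0 from hij] at hj
    obtain ⟨c, hc⟩ := LDG.SummationByParts.simple (LDG.norm_bloch h 0) (heig i 0 h0I) hj
      (hne i 0 h0I)
    have h1 := horth 0 h0I i j
    rw [if_neg hne', hc, Matrix.mulVec_smul, dotProduct_smul, hnorm i 0 h0I, smul_eq_mul,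
      mul_one] at h1
    exact hne j 0 h0I (by rw [hc, h1, zero_smul])
  refine ⟨?_, fun i ξ hξ => ?_⟩
  · obtain ⟨p, hp⟩ := hmem 0 h0I 0 S.e S.e_ne_zero (by
      rw [LDG.bloch_zero, LDG.SummationByParts.K_one_e, Complex.ofReal_zero, zero_smul])
    obtain ⟨c, hc⟩ := LDG.SummationByParts.eq_smul_e_of_K_one (S := S) (v := v p 0) (by
      have h1 := heig p 0 h0I
      rwa [LDG.bloch_zero, ← hp, Complex.ofReal_zero, zero_smul] at h1)
    have hc0 : c ≠ 0 := by
      rintro rfl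
      exact hne p 0 h0I (by rw [hc, zero_smul])
    refine ⟨p, ⟨hp.symm, ⟨c, hc0, hc⟩, ?_⟩, fun i hi => hinj (hi.1.trans hp), fun i hi => ?_⟩
    · have hmin : IsLocalMin (σ p) 0 := by
        filter_upwards [hInhds] with ξ hξ
        rw [← hp]; exact hnn p ξ hξ
      have h1 := LDG.SummationByParts.iteratedDeriv_two_eigenvalue (S := S)
        (LDG.analyticAt_bloch h 0) (LDG.bloch_zero h) (sys.analytic_val p 0 h0I)
        (sys.analytic_vec p 0 h0I) hp.symm hmin.deriv_eq_zero hc0 hc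
        (by filter_upwards [hInhds] with ξ hξ using heig p ξ hξ)
      have hμ : S.e ⬝ᵥ (S.M *ᵥ S.e) = h := by
        simp [hS, LDG.sbp, LDG.toComplex, LDG.massMatrix_zero_zero]
      rw [hμ, (LDG.hasDerivAt_bloch_zero h).deriv] at h1
      have h2 : ((iteratedDeriv 2 (σ p) 0 : ℝ) : ℂ) * (h : ℂ) ^ 2 = 2 * (h : ℂ) ^ 2 := by
        rw [h1]
        simp only [star_neg, star_mul', Complex.star_def, Complex.conj_I, Complex.conj_ofReal]
        linear_combination (-2 * (h : ℂ) ^ 2) * Complex.I_sq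
      have h3 : (h : ℂ) ^ 2 ≠ 0 := pow_ne_zero _ (by exact_mod_cast hh.ne')
      exact_mod_cast mul_right_cancel₀ h3 h2
    · refine lt_of_le_of_ne (hnn i 0 h0I) fun h0 => hi (hinj ?_)
      exact h0.symm.trans hp
  · have hnegI : ∀ x ∈ I, -x ∈ I := fun x hx => ⟨neg_le_neg hx.2, by linarith [hx.1]⟩
    -- The conjugate of an eigenvector at `-ξ` is an eigenvector at `ξ` for the same real value.
    -- Thus `σ i (-ξ)` is always a branch value at `ξ`, and it equals `σ i 0` at `0`, where the
    -- branches are distinct.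
    refine LDG.eqOn_branch (f := fun x => σ i (-x)) isPreconnected_Icc sys.analytic_val ?_ h0I
      hinj (by simp) ?_ hξ
    · intro x hx
      exact AnalyticAt.fun_comp (g := σ i) (f := fun x : ℝ => -x)
        (sys.analytic_val i _ (hnegI x hx)) analyticAt_id.fun_neg
    · filter_upwards [hInhds] with x hx
      refine hmem x hx _ (star (v i (-x))) (by simpa using hne i _ (hnegI x hx)) ?_
      have h1 := congrArg star (heig i _ (hnegI x hx))
      rw [LDG.SummationByParts.star_K_mulVec, LDG.bloch_neg, star_star, star_smul,
        LDG.SummationByParts.star_mulVec_map, S.star_M] at h1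
      simpa using h1
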